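/- All systems are finite-dimensional. Let $K\ge 0$, let $\mathcal N_{A_1\cdots A_K\to C}$ be a quantum multiple-access channel (a completely positive trace-preserving map) with $K$ senders and one receiver, and let $\theta_{S_1A_1},\dots,\theta_{S_KA_K}$ be arbitrary quantum states. Put $$\omega_{S_1\cdots S_KC}=\mathcal N_{A_1\cdots A_K\to C}(\theta_{S_1A_1}\otimes\cdots\otimes\theta_{S_KA_K}),$$ and for nonempty $\mathcal J\subseteq[K]=\{1,\dots,K\}$ put $$I'(S(\mathcal J);CS(\mathcal J^c))_\omega = H_2(C|S(\mathcal J^c))_\omega-H(C|S_1\cdots S_K)_\omega .$$ Here $H(C|S)=H(SC)-H(S)$, where $H$ is the von Neumann entropy in base $2$, and $H_2(A|B)_\rho=-\log_2\operatorname{Tr}\{\rho_{AB}\rho_B^{-1/2}\rho_{AB}\rho_B^{-1/2}\}$ is the collision conditional entropy. All inverses are taken on the support. **Theorem.** Every rate tuple $(R_1,\dots,R_K)$ with $$\sum_{j\in\mathcal J}R_j\le I'(S(\mathcal J);CS(\mathcal J^c))_\omega\qquad\text{for every nonempty }\mathcal J\subseteq[K]$$ is achievable for entanglement-assisted classical communication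 over $\mathcal N$ with a quantum simultaneous decoder. That is, for all $\varepsilon\in(0,1)$ and $\delta>0$ and all sufficiently large $n$, there is an entanglement-assisted code for $\mathcal N^{\otimes n}$ with $M_k=\lceil 2^{n(R_k-\delta)}\rceil$ messages for sender $k$, of the form described below, whose error probability averaged over all message tuples is at most $\varepsilon$. * Sender $k$ and the receiver share $M_k$ copies of $\theta_{S_kA_k}^{\otimes n}$, the receiver holding the $S$ systems. To send $m_k$, sender $k$ transmits the $A_k^n$ part of the $m_k$-th copy over $\mathcal N^{\otimes n}$. * The receiver decodes all messages at once by a square-root measurement. There is a test operator $0\le T\le I$ on $S_1^n\cdots S_K^nC^n$ such that, with $\Gamma^{m_1,\dots,m_K}$ the operator that acts as $T$ on the $m_k$-th copies of the $S_k^n$ $(k=1,\dots,K)$ and on $C^n$, and as the identity on all other copies, the decoding operators are $$\Lambda^{m_1,\dots,m_K}=\Big(\sum_{m'}\Gamma^{m'}\Big)^{-1/2}\Gamma^{m_1,\dots,m_K}\Big(\sum_{m'}\Gamma^{m'}\Big)^{-1/2}.$$ They are completed to a measurement by the failure outcome $I-\sum_m\Lambda^m$. -/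

import Mathlib

/-! Entanglement-assisted classical communication over a quantum multiple-access channel with `K`
senders. All systems are finite-dimensional: a system is a finite type (labelling an orthonormal
basis), an operator on it is a complex square matrix, and the tensor product of systems is the
product of the labelling types. -/

noncomputable section

namespace QMAC

open scoped Kronecker ComplexOrder

/-! ### States, channels, entropies -/

/-- Density operators: positive semi-definite with unit trace. -/
structure IsState {X : Type*} [Fintype X] (ρ : Matrix X X ℂ) : Prop where
  posSemidef : ρ.PosSemidef
  trace_eq_one : ρ.trace = 1

/-- `id_R ⊗ Φ`, applied blockwise: the `(r, r')` block of the output is `Φ` of the `(r, r')` block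
of the input. -/
def idTensor {A B : Type*} (R : Type*) (Φ : Matrix A A ℂ →ₗ[ℂ] Matrix B B ℂ)
    (X : Matrix (R × A) (R × A) ℂ) : Matrix (R × B) (R × B) ℂ :=
  Matrix.of fun p q => Φ (Matrix.of fun a a' => X (p.1, a) (q.1, a')) p.2 q.2

/-- Quantum channels: completely positive trace-preserving linear maps. -/
structure IsChannel {A B : Type*} [Fintype A] [Fintype B]
    (Φ : Matrix A A ℂ →ₗ[ℂ] Matrix B B ℂ) : Prop where
  completelyPositive : ∀ (d : ℕ) (X : Matrix (Fin d × A) (Fin d × A) ℂ),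
    X.PosSemidef → (idTensor (Fin d) Φ X).PosSemidef
  tracePreserving : ∀ X : Matrix A A ℂ, (Φ X).trace = X.trace

/-- `P ^ (-1/2)` for positive semi-definite `P`, the inverse being taken on the support of `P`
(the function `x ↦ (√x)⁻¹` sends `0` to `0`). -/
def invSqrt {X : Type*} [Fintype X] [DecidableEq X] (P : Matrix X X ℂ) : Matrix X X ℂ :=
  cfc (fun x : ℝ => (√x)⁻¹) P

/-- Partial trace over the second factor. -/
def traceRight {X Y : Type*} [Fintype Y] (ρ : Matrix (X × Y) (X × Y) ℂ) : Matrix X X ℂ :=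
  Matrix.of fun x x' => ∑ y, ρ (x, y) (x', y)

/-- The von Neumann entropy `H(ρ) = -Tr (ρ log₂ ρ)`. -/
def entropy {X : Type*} [Fintype X] [DecidableEq X] (ρ : Matrix X X ℂ) : ℝ :=
  (cfc Real.negMulLog ρ).trace.re / Real.log 2

/-- The conditional entropy `H(Y|X) = H(XY) - H(X)` of an operator on `X ⊗ Y`. -/
def condEntropy {X Y : Type*} [Fintype X] [DecidableEq X] [Fintype Y] [DecidableEq Y]
    (ρ : Matrix (X × Y) (X × Y) ℂ) : ℝ :=
  entropy ρ - entropy (traceRight ρ)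

/-- The collision conditional entropy
`H₂(Y|X) = -log₂ Tr (ρ_XY ρ_X^(-1/2) ρ_XY ρ_X^(-1/2))` of an operator on `X ⊗ Y`. -/
def collisionCondEntropy {X Y : Type*} [Fintype X] [DecidableEq X] [Fintype Y] [DecidableEq Y]
    (ρ : Matrix (X × Y) (X × Y) ℂ) : ℝ :=
  -Real.logb 2 (ρ * (invSqrt (traceRight ρ) ⊗ₖ (1 : Matrix Y Y ℂ)) * ρ *
    (invSqrt (traceRight ρ) ⊗ₖ (1 : Matrix Y Y ℂ))).trace.re

/-! ### Tensor products over several senders, slots or channel uses -/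

/-- `⊗ₖ ρ_k` for states `ρ_k` on `R_k ⊗ A_k`, reordered as a state on
`(R_1 ⊗ ⋯ ⊗ R_K) ⊗ (A_1 ⊗ ⋯ ⊗ A_K)`. -/
def tensorBipartite {ι : Type*} [Fintype ι] {R A : ι → Type*}
    (ρ : ∀ k, Matrix (R k × A k) (R k × A k) ℂ) :
    Matrix ((∀ k, R k) × (∀ k, A k)) ((∀ k, R k) × (∀ k, A k)) ℂ :=
  Matrix.of fun p q => ∏ k, ρ k (p.1 k, p.2 k) (q.1 k, q.2 k)

/-- `N^{⊗n}` for a multiple-access channel `N` from `A_1 ⊗ ⋯ ⊗ A_K` to `C`, the inputs being grouped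
by sender: sender `k` holds `A_k^{⊗n}`. This is the linear map that sends `⊗ₜ X_t` to `⊗ₜ N(X_t)`. -/
def channelPow {K : ℕ} {A : Fin K → Type*} {C : Type*}
    [∀ k, Fintype (A k)] [∀ k, DecidableEq (A k)]
    (N : Matrix (∀ k, A k) (∀ k, A k) ℂ →ₗ[ℂ] Matrix C C ℂ) (n : ℕ) :
    Matrix (∀ k, Fin n → A k) (∀ k, Fin n → A k) ℂ →ₗ[ℂ]
      Matrix (Fin n → C) (Fin n → C) ℂ where
  toFun X := Matrix.of fun c c' => ∑ a, ∑ a', X a a' *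
    ∏ t, N (Matrix.single (fun k => a k t) (fun k => a' k t) 1) (c t) (c' t)
  map_add' X Y := by
    ext c c'
    simp [add_mul, Finset.sum_add_distrib]
  map_smul' z X := by
    ext c c'
    simp [Finset.mul_sum, mul_assoc]

/-- Keep the tensor factor in slot `i` and trace out all the others. -/
def keepSlot {ι B : Type*} [Fintype ι] [DecidableEq ι] [Fintype B] [DecidableEq B] (i : ι) :
    Matrix (ι → B) (ι → B) ℂ →ₗ[ℂ] Matrix B B ℂ where
  toFun X := Matrix.of fun b b' => ∑ x : ι → B,
    if x i = b then X x (Function.update x i b') else 0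
  map_add' X Y := by
    ext b b'
    simp only [Matrix.of_apply, Matrix.add_apply, ← Finset.sum_add_distrib]
    refine Finset.sum_congr rfl fun x _ => ?_
    split_ifs <;> simp
  map_smul' z X := by
    ext b b'
    simp [Finset.mul_sum]

/-! ### Codes -/

/-- Entanglement-assisted codes for a multiple-access channel with inputs `B_1, …, B_K` and output
`D`, with `M_k` messages for sender `k`. Sender `k` and the receiver share a state on `R_k ⊗ A_k`,
the receiver holding `R_k`; the receiver finally measures `R_1 ⊗ ⋯ ⊗ R_K ⊗ D`. The outcome `none` of
the decoding measurement stands for a failure to decode. -/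
structure EACode {K : ℕ} (M : Fin K → ℕ) (R A B : Fin K → Type*) (D : Type*)
    [∀ k, Fintype (R k)] [∀ k, DecidableEq (R k)] [∀ k, Fintype (A k)] [∀ k, Fintype (B k)]
    [Fintype D] [DecidableEq D] where
  shared : ∀ k, Matrix (R k × A k) (R k × A k) ℂ
  shared_isState : ∀ k, IsState (shared k)
  encoder : ∀ k, Fin (M k) → (Matrix (A k) (A k) ℂ →ₗ[ℂ] Matrix (B k) (B k) ℂ)
  encoder_isChannel : ∀ k m, IsChannel (encoder k m)
  povm : Option (∀ k, Fin (M k)) → Matrix ((∀ k, R k) × D) ((∀ k, R k) × D) ℂ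
  povm_posSemidef : ∀ o, (povm o).PosSemidef
  povm_sum : ∑ o, povm o = 1

section

variable {K : ℕ} {M : Fin K → ℕ} {R A B : Fin K → Type*} {D : Type*}
  [∀ k, Fintype (R k)] [∀ k, DecidableEq (R k)] [∀ k, Fintype (A k)] [∀ k, Fintype (B k)]
  [Fintype D] [DecidableEq D]

/-- `p_e(m_1, …, m_K) = Tr ((I - Λ^m) N(⊗ₖ E_k^{m_k}(shared_k)))`. -/
def EACode.errorProb (code : EACode M R A B D)
    (N : Matrix (∀ k, B k) (∀ k, B k) ℂ →ₗ[ℂ] Matrix D D ℂ) (m : ∀ k, Fin (M k)) : ℝ :=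
  ((1 - code.povm (some m)) * idTensor (∀ k, R k) N
    (tensorBipartite fun k => idTensor (R k) (code.encoder k (m k)) (code.shared k))).trace.re

/-- The error probability averaged over all message tuples. -/
def EACode.avgErrorProb (code : EACode M R A B D)
    (N : Matrix (∀ k, B k) (∀ k, B k) ℂ →ₗ[ℂ] Matrix D D ℂ) : ℝ :=
  (∑ m, code.errorProb N m) / ∏ k, (M k : ℝ)

end

/-! ### Position-based codes with a quantum simultaneous decoder -/

section

variable {K : ℕ} {M : Fin K → ℕ} {S B : Fin K → Type*} {D : Type*}
  [∀ k, Fintype (S k)] [∀ k, DecidableEq (S k)] [∀ k, Fintype (B k)] [∀ k, DecidableEq (B k)]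
  [Fintype D] [DecidableEq D]

/-- Position-based encoding: sender `k` and the receiver share `M_k` copies of `θ_k`, a state on
`S_k ⊗ B_k`, and sender `k` transmits message `m` by sending the `B_k` part of the `m`-th copy. -/
structure EACode.IsPositionBased
    (code : EACode M (fun k => Fin (M k) → S k) (fun k => Fin (M k) → B k) B D)
    (θ : ∀ k, Matrix (S k × B k) (S k × B k) ℂ) : Prop where
  shared_eq : ∀ k, code.shared k = tensorBipartite fun _ : Fin (M k) => θ k
  encoder_eq : ∀ k m, code.encoder k m = keepSlot m

/-- The operator `Γ^{m_1, …, m_K}` that checks for the message tuple `m`: the test `T` on the `m_k`-th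
copies of the `S_k` together with `D`, and the identity on all the other copies. -/
def checkOperator (T : Matrix ((∀ k, S k) × D) ((∀ k, S k) × D) ℂ) (m : ∀ k, Fin (M k)) :
    Matrix ((∀ k, Fin (M k) → S k) × D) ((∀ k, Fin (M k) → S k) × D) ℂ :=
  Matrix.of fun p q =>
    if ∀ k i, i ≠ m k → p.1 k i = q.1 k i then
      T (fun k => p.1 k (m k), p.2) (fun k => q.1 k (m k), q.2)
    else 0

/-- Quantum simultaneous decoder: all messages are decoded at once, by the square-root measurement
`Λ^m = (∑ Γ^{m'})^{-1/2} Γ^m (∑ Γ^{m'})^{-1/2}` built from one test operator `0 ≤ T ≤ I`. -/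
def EACode.HasSimultaneousDecoder
    (code : EACode M (fun k => Fin (M k) → S k) (fun k => Fin (M k) → B k) B D) : Prop :=
  ∃ T : Matrix ((∀ k, S k) × D) ((∀ k, S k) × D) ℂ,
    T.PosSemidef ∧ (1 - T).PosSemidef ∧
    ∀ m : ∀ k, Fin (M k), code.povm (some m) =
      invSqrt (∑ m' : ∀ k, Fin (M k), checkOperator T m') * checkOperator T m *
        invSqrt (∑ m' : ∀ k, Fin (M k), checkOperator T m')

end

/-! ### Achievable rates -/

section

variable {K : ℕ} {S A : Fin K → Type*} {C : Type*}
  [∀ k, Fintype (S k)] [∀ k, DecidableEq (S k)] [∀ k, Fintype (A k)] [∀ k, DecidableEq (A k)]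
  [Fintype C] [DecidableEq C]

/-- The rates `rate_1, …, rate_K` are achievable over `N` with a quantum simultaneous decoder, the
shared entanglement consisting of copies of the `θ_k`: for all `ε ∈ (0, 1)`, `δ > 0` and all
sufficiently large `n` there is a code for `N^{⊗n}` with `2^{n(rate_k - δ)}` (rounded up) messages
for sender `k`, average error probability at most `ε`, and such a decoder. -/
def AchievableBySimultaneousDecoding
    (N : Matrix (∀ k, A k) (∀ k, A k) ℂ →ₗ[ℂ] Matrix C C ℂ)
    (θ : ∀ k, Matrix (S k × A k) (S k × A k) ℂ) (rate : Fin K → ℝ) : Prop :=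
  ∀ ε : ℝ, 0 < ε → ε < 1 → ∀ δ : ℝ, 0 < δ → ∀ᶠ n : ℕ in Filter.atTop,
    ∃ code : EACode (fun k => ⌈(2 : ℝ) ^ ((n : ℝ) * (rate k - δ))⌉₊)
        (fun k => Fin ⌈(2 : ℝ) ^ ((n : ℝ) * (rate k - δ))⌉₊ → (Fin n → S k))
        (fun k => Fin ⌈(2 : ℝ) ^ ((n : ℝ) * (rate k - δ))⌉₊ → (Fin n → A k))
        (fun k => Fin n → A k) (Fin n → C),
      code.IsPositionBased (fun k => tensorBipartite fun _ : Fin n => θ k) ∧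
      code.HasSimultaneousDecoder ∧
      code.avgErrorProb (channelPow N n) ≤ ε

/-- The state `ω = N(θ_1 ⊗ ⋯ ⊗ θ_K)` on `(S_1 ⊗ ⋯ ⊗ S_K) ⊗ C`. -/
def outputState (N : Matrix (∀ k, A k) (∀ k, A k) ℂ →ₗ[ℂ] Matrix C C ℂ)
    (θ : ∀ k, Matrix (S k × A k) (S k × A k) ℂ) :
    Matrix ((∀ k, S k) × C) ((∀ k, S k) × C) ℂ :=
  idTensor (∀ k, S k) N (tensorBipartite θ)

/-- The marginal on `S(Jᶜ) ⊗ C` of an operator on `(S_1 ⊗ ⋯ ⊗ S_K) ⊗ C`. -/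
def marginalCompl (J : Finset (Fin K)) (ω : Matrix ((∀ k, S k) × C) ((∀ k, S k) × C) ℂ) :
    Matrix ((∀ k : {k // k ∉ J}, S k) × C) ((∀ k : {k // k ∉ J}, S k) × C) ℂ :=
  Matrix.of fun p q => ∑ t : (∀ k : {k // k ∈ J}, S k),
    ω ((Equiv.piEquivPiSubtypeProd (· ∈ J) S).symm (t, p.1), p.2)
      ((Equiv.piEquivPiSubtypeProd (· ∈ J) S).symm (t, q.1), q.2)

/-- `I'(S(J); C S(Jᶜ)) = H₂(C | S(Jᶜ)) - H(C | S_1 ⋯ S_K)`. -/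
def altMutualInfo (J : Finset (Fin K)) (ω : Matrix ((∀ k, S k) × C) ((∀ k, S k) × C) ℂ) : ℝ :=
  collisionCondEntropy (marginalCompl J ω) - condEntropy ω

end

end QMAC

end

noncomputable section

namespace QMAC

open Matrix
open scoped Kronecker ComplexOrder MatrixOrder

/-! ### Positive semi-definite matrices -/

section PosSemidef

variable {X : Type*} [Fintype X]

/-! Write `σ_k` for the marginal of `θ_k` on `S_k`, `H` for entropy in nats, and `ω_J` for `⊗_{j ∈
J} σ_j ⊗ Tr_{S(J)} ω`. Position-based encoding turns decoding into hypothesis testing: if the sent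
tuple and a candidate differ exactly at the senders in `J`, the overlap of the candidate's check
operator with the received state is `Tr (T ω_J)` (`trace_checkOperator_mul_messageState`). The
Hayashi–Nagaoka inequality then bounds the error by `2 Tr ((1 - T) ω) + 4 ∑_J ∏_{j ∈ J} (M_j - 1) Tr
(T ω_J)`, over nonempty `J`. A single test has to serve all `J` at once.

On `n` copies the test is `T = Q P Q`. Here `P` projects onto the eigenvectors of `ω^{⊗n}` with
eigenvalue at least `e^{-n(H(ω) + δ)}`, so that `P ≤ a ω^{⊗n}` with `a = e^{n(H(ω) + δ)}`. The
operator `Q` is a product over the senders of projections onto the eigenvectors of `σ_k^{⊗n}` with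
positive eigenvalue at most `b_k = e^{-n(H(σ_k) - δ)}`.

The second error is bounded in `re_trace_mul_crossState_le`. Replacing `P` by `a ω^{⊗n}` leaves `a
Tr (ω^{⊗n} Q ω_J^{⊗n} Q)`. On the systems in `J`, conjugation of the state by `Q` gives at most
`∏_{j ∈ J} b_j`, and there remains `Tr (m Q m Q)` with `m` the marginal of `ω^{⊗n}` on `S(Jᶜ) C`.
There `Q` is at most `∏ √b_k` times the inverse square root of the marginal state; using this twice
produces `∏_{k ∉ J} b_k` times the collision trace. The prefactor `a ∏_k b_k = e^{n(ln 2 · H(C|S) +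
(K + 1) δ)}` is the same for every `J`, because the marginal of `ω` on the `S_k` is a product. As
the collision trace is multiplicative, the exponent is `I'` up to `(K + 1) δ`.

The first error needs no commutation of `P` and `Q`: a noncommutative union bound reduces it to the
two separate failure probabilities, which vanish by a Chernoff estimate. -/

lemma re_trace_mul_nonneg {A B : Matrix X X ℂ} (hA : A.PosSemidef) (hB : B.PosSemidef) :
    0 ≤ (A * B).trace.re := by
  classical
  obtain ⟨C, rfl⟩ := CStarAlgebra.nonneg_iff_eq_star_mul_self.mp hB.nonneg
  have h : (A * (star C * C)).trace = (C * A * Cᴴ).trace := by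
    rw [← Matrix.mul_assoc, Matrix.trace_mul_comm, ← Matrix.mul_assoc, star_eq_conjTranspose]
  rw [h]
  exact (Complex.le_def.mp (hA.mul_mul_conjTranspose_same C).trace_nonneg).1

lemma re_trace_mul_le_left {A B C : Matrix X X ℂ} (h : A ≤ B) (hC : C.PosSemidef) :
    (A * C).trace.re ≤ (B * C).trace.re := by
  have := re_trace_mul_nonneg (Matrix.le_iff.mp h) hC
  rw [Matrix.sub_mul, Matrix.trace_sub, Complex.sub_re] at this
  linarith

lemma re_trace_mul_le_right {A B C : Matrix X X ℂ} (h : A ≤ B) (hC : C.PosSemidef) :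
    (C * A).trace.re ≤ (C * B).trace.re := by
  rw [Matrix.trace_mul_comm C A, Matrix.trace_mul_comm C B]
  exact re_trace_mul_le_left h hC

/-- Monotonicity of the square root. -/
lemma le_of_mul_self_le_mul_self [DecidableEq X] {A B : Matrix X X ℂ} (hA : A.PosSemidef)
    (hB : B.PosSemidef) (h : A * A ≤ B * B) : A ≤ B := by
  have hD : (B - A).IsHermitian := hB.1.sub hA.1
  rw [Matrix.le_iff, hD.posSemidef_iff_eigenvalues_nonneg]
  intro i
  by_contra hi
  simp only [Pi.zero_apply, not_le] at hi
  set μ := hD.eigenvalues i with hμ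
  set v : X → ℂ := (hD.eigenvectorBasis i).ofLp with hv
  have hDv : (B - A) *ᵥ v = (μ : ℂ) • v := by
    have := hD.mulVec_eigenvectorBasis i
    rw [this]; rfl
  have hvD : star v ᵥ* (B - A) = (μ : ℂ) • star v := by
    have := congrArg star hDv
    rw [star_mulVec, hD.eq] at this
    rw [this]; ext; simp
  have hn : star v ⬝ᵥ v = 1 := by
    have := hD.eigenvectorBasis.orthonormal.1 i
    have h2 : inner ℂ (hD.eigenvectorBasis i) (hD.eigenvectorBasis i) = (1 : ℂ) := by
      rw [inner_self_eq_norm_sq_to_K, this]; simp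
    rw [EuclideanSpace.inner_eq_star_dotProduct, dotProduct_comm] at h2
    exact h2
  have ha := hA.dotProduct_mulVec_nonneg v
  have hb := hB.dotProduct_mulVec_nonneg v
  have hd := (Matrix.le_iff.mp h).dotProduct_mulVec_nonneg v
  -- For the unit eigenvector `v` of `B - A` with eigenvalue `μ < 0` this splitting gives `μ (⟨A⟩ +
  -- ⟨B⟩) ≥ 0`. Both expectations then vanish, contradicting `⟨B⟩ - ⟨A⟩ = μ`.
  have e1 : B * B - A * A = B * (B - A) + (B - A) * A := by noncomm_ring
  rw [e1, add_mulVec, dotProduct_add, ← mulVec_mulVec, ← mulVec_mulVec, hDv,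
    mulVec_smul, dotProduct_smul, dotProduct_mulVec (star v) (B - A), hvD, smul_dotProduct] at hd
  have e2 : star v ⬝ᵥ (B *ᵥ v) - star v ⬝ᵥ (A *ᵥ v) = μ := by
    rw [← dotProduct_sub, ← sub_mulVec, hDv, dotProduct_smul, hn]; simp
  have ha' := (Complex.le_def.mp ha).1
  have hb' := (Complex.le_def.mp hb).1
  have hd' := (Complex.le_def.mp hd).1
  have e2' := congrArg Complex.re e2
  simp at ha' hb' hd' e2'
  nlinarith

end PosSemidef

/-! ### Diagonalization -/

section Diagonalization

variable {X : Type*} [Fintype X] [DecidableEq X]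

/-- The matrix with eigenvalues `d` and eigenvectors the columns of `U`. -/
def ofEigen (U : Matrix X X ℂ) (d : X → ℝ) : Matrix X X ℂ :=
  U * diagonal (fun i => (d i : ℂ)) * Uᴴ

variable {U : Matrix X X ℂ}

lemma ofEigen_mul (hU : Uᴴ * U = 1) (d e : X → ℝ) :
    ofEigen U d * ofEigen U e = ofEigen U (fun i => d i * e i) := by
  have : (ofEigen U d * ofEigen U e) =
      U * diagonal (fun i => (d i : ℂ)) * (Uᴴ * U) * diagonal (fun i => (e i : ℂ)) * Uᴴ := by
    simp only [ofEigen, Matrix.mul_assoc]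
  rw [this, hU, Matrix.mul_one, Matrix.mul_assoc U, diagonal_mul_diagonal]
  simp [ofEigen]

lemma ofEigen_one (hU : Uᴴ * U = 1) : ofEigen U (fun _ => 1) = 1 := by
  simp [ofEigen, mul_eq_one_comm.mp hU]

lemma ofEigen_sub (d e : X → ℝ) :
    ofEigen U d - ofEigen U e = ofEigen U (fun i => d i - e i) := by
  simp only [ofEigen]
  rw [← Matrix.sub_mul, ← Matrix.mul_sub, diagonal_sub]
  simp

lemma ofEigen_add (d e : X → ℝ) :
    ofEigen U d + ofEigen U e = ofEigen U (fun i => d i + e i) := by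
  simp only [ofEigen]
  rw [← Matrix.add_mul, ← Matrix.mul_add, diagonal_add]
  simp

lemma ofEigen_smul (c : ℝ) (d : X → ℝ) :
    (c : ℂ) • ofEigen U d = ofEigen U (fun i => c * d i) := by
  simp only [ofEigen]
  rw [← Matrix.smul_mul, ← Matrix.mul_smul, ← diagonal_smul]
  congr 3
  ext i; simp

lemma ofEigen_posSemidef (U : Matrix X X ℂ) {d : X → ℝ} (hd : ∀ i, 0 ≤ d i) :
    (ofEigen U d).PosSemidef :=
  (PosSemidef.diagonal (Pi.le_def.mpr fun i => by simpa using hd i)).mul_mul_conjTranspose_same U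

lemma ofEigen_mono (U : Matrix X X ℂ) {d e : X → ℝ} (h : ∀ i, d i ≤ e i) :
    ofEigen U d ≤ ofEigen U e := by
  rw [Matrix.le_iff, ofEigen_sub]
  exact ofEigen_posSemidef U fun i => sub_nonneg.mpr (h i)

lemma ofEigen_conjTranspose (U : Matrix X X ℂ) (d : X → ℝ) : (ofEigen U d)ᴴ = ofEigen U d := by
  simp only [ofEigen, conjTranspose_mul, conjTranspose_conjTranspose, diagonal_conjTranspose,
    Matrix.mul_assoc]
  congr 3
  ext i; simp

lemma trace_ofEigen (hU : Uᴴ * U = 1) (d : X → ℝ) : (ofEigen U d).trace = ∑ i, (d i : ℂ) := by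
  rw [ofEigen, Matrix.trace_mul_comm, ← Matrix.mul_assoc, hU, Matrix.one_mul, trace_diagonal]

lemma exists_ofEigen {A : Matrix X X ℂ} (hA : A.IsHermitian) :
    ∃ (U : Matrix X X ℂ) (d : X → ℝ), Uᴴ * U = 1 ∧ A = ofEigen U d ∧
      (A.PosSemidef → ∀ i, 0 ≤ d i) := by
  refine ⟨hA.eigenvectorUnitary, hA.eigenvalues, ?_, ?_, fun h => h.eigenvalues_nonneg⟩
  · exact Unitary.coe_star_mul_self hA.eigenvectorUnitary
  · conv_lhs => rw [hA.spectral_theorem]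
    rfl

/-- On the finitely many eigenvalues `f` agrees with a Lagrange interpolation polynomial, and
polynomials act on eigenvalues. Functions of a matrix can thus be computed in any chosen
diagonalization. -/
lemma cfc_ofEigen (hU : Uᴴ * U = 1) (f : ℝ → ℝ) (d : X → ℝ) :
    cfc f (ofEigen U d) = ofEigen U (fun i => f (d i)) := by
  have hsa : IsSelfAdjoint (ofEigen U d) := ofEigen_conjTranspose U d
  obtain ⟨q, hq⟩ : ∃ q : Polynomial ℝ, ∀ i, q.eval (d i) = f (d i) := by
    refine ⟨Lagrange.interpolate (Finset.univ.image d) id f, fun i => ?_⟩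
    exact Lagrange.eval_interpolate_at_node f (s := Finset.univ.image d) (v := id)
      Function.injective_id.injOn (by simp : d i ∈ Finset.univ.image d)
  have haev : ∀ q : Polynomial ℝ,
      Polynomial.aeval (ofEigen U d) q = ofEigen U (fun i => q.eval (d i)) := by
    intro q
    induction q using Polynomial.induction_on' with
    | add p q hp hq => simp [hp, hq, ofEigen_add]
    | monomial k c =>
      have hpow : ofEigen U d ^ k = ofEigen U (fun i => d i ^ k) := by
        induction k with
        | zero => simp [ofEigen_one hU]
        | succ k ih => rw [pow_succ, ih, ofEigen_mul hU]; simp [pow_succ]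
      rw [Polynomial.aeval_monomial, hpow]
      simp only [Polynomial.eval_monomial]
      rw [← ofEigen_smul, ← Algebra.smul_def]
      rfl
  have hspec : spectrum ℝ (ofEigen U d) ⊆ Set.range d := by
    intro r hr
    by_contra hne
    apply hr
    have hne' : ∀ i, r - d i ≠ 0 := fun i h => hne ⟨i, by linarith⟩
    have e : algebraMap ℝ (Matrix X X ℂ) r - ofEigen U d = ofEigen U (fun i => r - d i) := by
      rw [← ofEigen_sub]
      congr 1
      have := ofEigen_smul (U := U) r (fun _ => 1)
      rw [ofEigen_one hU] at this
      simp only [mul_one] at this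
      rw [← this, Algebra.algebraMap_eq_smul_one]
      rfl
    rw [spectrum.mem_resolventSet_iff, e]
    refine IsUnit.of_mul_eq_one (ofEigen U (fun i => (r - d i)⁻¹)) ?_
    · rw [ofEigen_mul hU]
      simp [hne', ofEigen_one hU]
  calc cfc f (ofEigen U d) = cfc (fun x => q.eval x) (ofEigen U d) := by
        refine cfc_congr fun x hx => ?_
        obtain ⟨i, rfl⟩ := hspec hx
        exact (hq i).symm
    _ = ofEigen U (fun i => f (d i)) := by
        rw [cfc_polynomial q _ hsa, haev]
        simp [hq]

end Diagonalization

/-! ### The square-root measurement -/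

section SquareRoot

variable {X : Type*} [Fintype X] [DecidableEq X]

lemma invSqrt_conjTranspose {G : Matrix X X ℂ} (hG : G.PosSemidef) : (invSqrt G)ᴴ = invSqrt G := by
  obtain ⟨U, d, hU, rfl, -⟩ := exists_ofEigen hG.1
  rw [invSqrt, cfc_ofEigen hU, ofEigen_conjTranspose]

lemma invSqrt_posSemidef {G : Matrix X X ℂ} (hG : G.PosSemidef) : (invSqrt G).PosSemidef := by
  obtain ⟨U, d, hU, rfl, -⟩ := exists_ofEigen hG.1
  rw [invSqrt, cfc_ofEigen hU]
  exact ofEigen_posSemidef U fun i => by positivity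

lemma invSqrt_mul_self_mul_invSqrt_le_one {G : Matrix X X ℂ} (hG : G.PosSemidef) :
    invSqrt G * G * invSqrt G ≤ 1 := by
  obtain ⟨U, d, hU, rfl, hd⟩ := exists_ofEigen hG.1
  rw [invSqrt, cfc_ofEigen hU, ofEigen_mul hU, ofEigen_mul hU, ← ofEigen_one hU]
  refine ofEigen_mono U fun i => ?_
  rcases (hd hG i).eq_or_lt with h | h
  · simp [← h]
  · have := Real.mul_self_sqrt h.le
    have h0 := Real.sqrt_pos.mpr h
    refine le_of_eq ?_
    field_simp
    nlinarith

/-- The Hayashi–Nagaoka operator inequality. -/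
lemma hayashi_nagaoka {S T : Matrix X X ℂ} (hS : S.PosSemidef) (hS1 : S ≤ 1)
    (hT : T.PosSemidef) :
    1 - invSqrt (S + T) * S * invSqrt (S + T) ≤ (2 : ℂ) • (1 - S) + (4 : ℂ) • T := by
  have hG : (S + T).PosSemidef := hS.add hT
  obtain ⟨U, d, hU, hGU, hd⟩ := exists_ofEigen hG.1
  replace hd := hd hG
  obtain ⟨q, hq⟩ : ∃ q, q = ofEigen U (fun i => √(d i)) := ⟨_, rfl⟩
  obtain ⟨p, hp⟩ : ∃ p, p = ofEigen U (fun i => if d i = 0 then 0 else 1) := ⟨_, rfl⟩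
  have hR : invSqrt (S + T) = ofEigen U (fun i => (√(d i))⁻¹) := by
    rw [hGU, invSqrt, cfc_ofEigen hU]
  obtain ⟨R, hRdef⟩ : ∃ R, R = invSqrt (S + T) := ⟨_, rfl⟩
  rw [← hRdef]
  rw [← hRdef] at hR
  have hsq : ∀ i, √(d i) * √(d i) = d i := fun i => Real.mul_self_sqrt (hd i)
  have hne : ∀ i, d i ≠ 0 → √(d i) ≠ 0 := fun i h => (Real.sqrt_pos.mpr ((hd i).lt_of_ne' h)).ne'
  have hRG : R * (S + T) = q := by
    rw [hR, hGU, hq, ofEigen_mul hU]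
    congr 1; ext i
    by_cases h : d i = 0
    · simp [h]
    · have := hne i h; field_simp; rw [sq, hsq]
  have hGR : (S + T) * R = q := by
    rw [hR, hGU, hq, ofEigen_mul hU]
    congr 1; ext i
    by_cases h : d i = 0
    · simp [h]
    · have := hne i h; field_simp; rw [sq, hsq]
  have hqR : q * R = p := by
    rw [hR, hp, hq, ofEigen_mul hU]
    congr 1; ext i
    by_cases h : d i = 0
    · simp [h]
    · have := hne i h; simp [this, h]
  have hqps : q.PosSemidef := hq ▸ ofEigen_posSemidef U fun i => Real.sqrt_nonneg _
  have hqq : q * q = S + T := by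
    rw [hGU, hq, ofEigen_mul hU]; simp [hsq]
  have hp1 : (1 - p).PosSemidef := by
    rw [hp, ← ofEigen_one hU, ofEigen_sub]
    refine ofEigen_posSemidef U fun i => ?_
    split_ifs <;> norm_num
  have hRH : Rᴴ = R := by rw [hR, ofEigen_conjTranspose]
  have hSS : S * S ≤ S := by
    have h1 : (S * (1 - S) * Sᴴ + (1 - S) * S * (1 - S)ᴴ).PosSemidef :=
      ((Matrix.le_iff.mp hS1).mul_mul_conjTranspose_same S).add
        (hS.mul_mul_conjTranspose_same (1 - S))
    rw [Matrix.le_iff]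
    have e : S - S * S = S * (1 - S) * Sᴴ + (1 - S) * S * (1 - S)ᴴ := by
      rw [conjTranspose_sub, conjTranspose_one, hS.1.eq]
      noncomm_ring
    rwa [e]
  -- `S² ≤ S ≤ S + T = q²`, and the square root is operator monotone.
  have hSq : (q - S).PosSemidef := by
    refine Matrix.le_iff.mp (le_of_mul_self_le_mul_self hS hqps (hSS.trans ?_))
    rw [hqq, Matrix.le_iff]
    simpa using hT
  have h2 : ((R - 1) * S * (R - 1)ᴴ).PosSemidef := hS.mul_mul_conjTranspose_same _
  have h3 : ((R - 1 - 1) * T * (R - 1 - 1)ᴴ).PosSemidef := hT.mul_mul_conjTranspose_same _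
  have c2 : (0 : ℂ) ≤ 2 := by norm_num
  have c4 : (0 : ℂ) ≤ 4 := by norm_num
  have key := ((hp1.add (h2.smul c2)).add h3).add (hSq.smul c4)
  -- The difference is a sum of four positive terms. The cross terms in `R` cancel against `4q`,
  -- because `R (S + T) = (S + T) R = q`.
  have e : (2 : ℂ) • (1 - S) + (4 : ℂ) • T - (1 - R * S * R) =
      1 - p + (2 : ℂ) • ((R - 1) * S * (R - 1)ᴴ) + (R - 1 - 1) * T * (R - 1 - 1)ᴴ +
        (4 : ℂ) • (q - S) := by
    have hpE : p = R * (S * R) + R * (T * R) := by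
      rw [← hqR, ← hRG]; noncomm_ring
    have hqE : (4 : ℂ) • q = (2 : ℂ) • (R * S + R * T) + (2 : ℂ) • (S * R + T * R) := by
      rw [← Matrix.mul_add, ← Matrix.add_mul, hRG, hGR]; module
    simp only [conjTranspose_sub, conjTranspose_one, hRH]
    rw [smul_sub _ q, hqE, hpE]
    simp only [Matrix.mul_sub, Matrix.sub_mul, Matrix.mul_one, Matrix.one_mul, Matrix.mul_assoc]
    module
  rwa [Matrix.le_iff, e]

end SquareRoot

/-! ### Tensor products over a finite index type -/

section PiTensor

variable {ι : Type*} [Fintype ι]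

/-- The tensor product of a finite family of matrices. -/
def piTensor {X Y : ι → Type*} (M : ∀ k, Matrix (X k) (Y k) ℂ) :
    Matrix (∀ k, X k) (∀ k, Y k) ℂ :=
  Matrix.of fun x y => ∏ k, M k (x k) (y k)

lemma sum_prod_eq_prod_sum [DecidableEq ι] {R : Type*} [CommSemiring R] {X : ι → Type*}
    [∀ k, Fintype (X k)] (f : ∀ k, X k → R) :
    ∑ x : ∀ k, X k, ∏ k, f k (x k) = ∏ k, ∑ x, f k x := by
  rw [Finset.prod_univ_sum, Fintype.piFinset_univ]

lemma prod_ite_eq_one {R : Type*} [CommSemiring R] {X : ι → Type*} [∀ k, DecidableEq (X k)]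
    (x y : ∀ k, X k) :
    (∏ k, if x k = y k then (1 : R) else 0) = if x = y then 1 else 0 := by
  split_ifs with h
  · simp [h]
  · obtain ⟨k, hk⟩ := Function.ne_iff.mp h
    exact Finset.prod_eq_zero (Finset.mem_univ k) (if_neg hk)

variable {X Y Z : ι → Type*}

lemma piTensor_mul [DecidableEq ι] [∀ k, Fintype (Y k)] (M : ∀ k, Matrix (X k) (Y k) ℂ)
    (N : ∀ k, Matrix (Y k) (Z k) ℂ) :
    piTensor M * piTensor N = piTensor fun k => M k * N k := by
  ext x z
  simp only [piTensor, mul_apply, of_apply, ← Finset.prod_mul_distrib]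
  exact sum_prod_eq_prod_sum fun k y => M k (x k) y * N k y (z k)

lemma piTensor_one [∀ k, DecidableEq (X k)] :
    piTensor (fun k => (1 : Matrix (X k) (X k) ℂ)) = 1 := by
  ext x y
  simp only [piTensor, of_apply, one_apply]
  exact prod_ite_eq_one x y

lemma piTensor_conjTranspose (M : ∀ k, Matrix (X k) (Y k) ℂ) :
    (piTensor M)ᴴ = piTensor fun k => (M k)ᴴ := by
  ext x y
  simp [piTensor]

lemma piTensor_trace [DecidableEq ι] [∀ k, Fintype (X k)] (M : ∀ k, Matrix (X k) (X k) ℂ) :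
    (piTensor M).trace = ∏ k, (M k).trace :=
  sum_prod_eq_prod_sum fun k x => M k x x

lemma piTensor_diagonal [∀ k, DecidableEq (X k)] (d : ∀ k, X k → ℂ) :
    piTensor (fun k => diagonal (d k)) = diagonal fun x => ∏ k, d k (x k) := by
  ext x y
  simp only [piTensor, of_apply, diagonal_apply]
  split_ifs with h
  · simp [h]
  · obtain ⟨k, hk⟩ := Function.ne_iff.mp h
    exact Finset.prod_eq_zero (Finset.mem_univ k) (if_neg hk)

lemma piTensor_posSemidef [DecidableEq ι] [∀ k, Fintype (X k)] [∀ k, DecidableEq (X k)]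
    {M : ∀ k, Matrix (X k) (X k) ℂ} (hM : ∀ k, (M k).PosSemidef) : (piTensor M).PosSemidef := by
  choose C hC using fun k => CStarAlgebra.nonneg_iff_eq_star_mul_self.mp (hM k).nonneg
  have : piTensor M = (piTensor C)ᴴ * piTensor C := by
    rw [piTensor_conjTranspose, piTensor_mul]
    exact congrArg piTensor (funext hC)
  rw [this]
  exact posSemidef_conjTranspose_mul_self _

lemma piTensor_ofEigen [DecidableEq ι] [∀ k, Fintype (X k)] [∀ k, DecidableEq (X k)]
    (U : ∀ k, Matrix (X k) (X k) ℂ) (d : ∀ k, X k → ℝ) :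
    piTensor (fun k => ofEigen (U k) (d k)) =
      ofEigen (piTensor U) fun x => ∏ k, d k (x k) := by
  simp only [ofEigen]
  rw [← piTensor_mul, ← piTensor_mul, piTensor_diagonal, piTensor_conjTranspose]
  simp

lemma piTensor_unitary [DecidableEq ι] [∀ k, Fintype (X k)] [∀ k, DecidableEq (X k)]
    {U : ∀ k, Matrix (X k) (X k) ℂ} (hU : ∀ k, (U k)ᴴ * U k = 1) :
    (piTensor U)ᴴ * piTensor U = 1 := by
  rw [piTensor_conjTranspose, piTensor_mul, ← piTensor_one]
  exact congrArg piTensor (funext hU)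

lemma tensorBipartite_eq_submatrix (ρ : ∀ k, Matrix (X k × Y k) (X k × Y k) ℂ) :
    tensorBipartite ρ = (piTensor ρ).submatrix (fun p k => (p.1 k, p.2 k))
      (fun p k => (p.1 k, p.2 k)) := rfl

lemma traceRight_tensorBipartite [DecidableEq ι] [∀ k, Fintype (Y k)]
    (ρ : ∀ k, Matrix (X k × Y k) (X k × Y k) ℂ) :
    traceRight (tensorBipartite ρ) = piTensor fun k => traceRight (ρ k) := by
  ext x x'
  exact sum_prod_eq_prod_sum fun k y => ρ k (x k, y) (x' k, y)

end PiTensor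

/-! ### Partial trace -/

section TraceRight

variable {X Y : Type*} [Fintype Y]

lemma trace_traceRight [Fintype X] (ρ : Matrix (X × Y) (X × Y) ℂ) :
    (traceRight ρ).trace = ρ.trace := by
  simp [Matrix.trace, traceRight, Fintype.sum_prod_type]

lemma traceRight_posSemidef [Fintype X] {ρ : Matrix (X × Y) (X × Y) ℂ} (hρ : ρ.PosSemidef) :
    (traceRight ρ).PosSemidef := by
  have : traceRight ρ = ∑ y, ρ.submatrix (fun x => (x, y)) (fun x => (x, y)) := by
    ext x x'
    simp [traceRight, Matrix.sum_apply]
  rw [this]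
  exact posSemidef_sum _ fun y _ => hρ.submatrix _

lemma IsState.traceRight [Fintype X] {ρ : Matrix (X × Y) (X × Y) ℂ} (hρ : IsState ρ) :
    IsState (traceRight ρ) :=
  ⟨traceRight_posSemidef hρ.1, by rw [trace_traceRight, hρ.2]⟩

lemma IsState.tensorBipartite {ι : Type*} [Fintype ι] [DecidableEq ι] {X Y : ι → Type*}
    [∀ k, Fintype (X k)] [∀ k, Fintype (Y k)] {ρ : ∀ k, Matrix (X k × Y k) (X k × Y k) ℂ}
    (hρ : ∀ k, IsState (ρ k)) : IsState (tensorBipartite ρ) := by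
  classical
  refine ⟨?_, ?_⟩
  · rw [tensorBipartite_eq_submatrix]
    exact (piTensor_posSemidef fun k => (hρ k).1).submatrix _
  · rw [← trace_traceRight, traceRight_tensorBipartite, piTensor_trace]
    simp [trace_traceRight, (hρ _).2]

end TraceRight

/-! ### Channels -/

section Channels

/-- Complete positivity is stated only for reference systems `Fin d`; relabelling extends it to any
finite one. -/
lemma idTensor_posSemidef {A B R : Type*} [Fintype A] [Fintype B] [Fintype R]
    {Φ : Matrix A A ℂ →ₗ[ℂ] Matrix B B ℂ} (hΦ : IsChannel Φ) {X : Matrix (R × A) (R × A) ℂ}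
    (hX : X.PosSemidef) : (idTensor R Φ X).PosSemidef := by
  let e := Fintype.equivFin R
  have := (hΦ.completelyPositive _ _ (hX.submatrix
    (fun p : Fin (Fintype.card R) × A => (e.symm p.1, p.2)))).submatrix
      (fun p : R × B => (e p.1, p.2))
  convert this using 1
  ext p q
  simp [idTensor]

/-- Trace preservation holds in each block. This is why `ω` has a product marginal on the `S_k`. -/
lemma traceRight_idTensor {A B R : Type*} [Fintype A] [Fintype B]
    {Φ : Matrix A A ℂ →ₗ[ℂ] Matrix B B ℂ} (hΦ : IsChannel Φ) (X : Matrix (R × A) (R × A) ℂ) :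
    traceRight (idTensor R Φ X) = traceRight X := by
  ext r r'
  exact hΦ.tracePreserving (Matrix.of fun a a' => X (r, a) (r', a'))

variable {ι B : Type*} [Fintype ι] [DecidableEq ι] [Fintype B] [DecidableEq B]

/-- Splitting off slot `i` exhibits the map as a sum of principal submatrices, from which complete
positivity is visible. -/
lemma keepSlot_apply (i : ι) (X : Matrix (ι → B) (ι → B) ℂ) (b b' : B) :
    keepSlot i X b b' = ∑ y, X ((Equiv.funSplitAt i B).symm (b, y))
      ((Equiv.funSplitAt i B).symm (b', y)) := by
  change (∑ x : ι → B, if x i = b then X x (Function.update x i b') else 0) = _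
  rw [← (Equiv.funSplitAt i B).symm.sum_comp, Fintype.sum_prod_type, Finset.sum_comm]
  refine Finset.sum_congr rfl fun y _ => ?_
  rw [Finset.sum_eq_single b]
  · have h1 : (Equiv.funSplitAt i B).symm (b, y) i = b := by simp
    have h2 : Function.update ((Equiv.funSplitAt i B).symm (b, y)) i b' =
        (Equiv.funSplitAt i B).symm (b', y) := by
      ext j
      by_cases h : j = i
      · subst h; simp
      · simp [h]
    rw [if_pos h1, h2]
  · intro a _ ha
    have h1 : (Equiv.funSplitAt i B).symm (a, y) i = a := by simp
    rw [h1, if_neg ha]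
  · simp

lemma keepSlot_isChannel (i : ι) : IsChannel (keepSlot (B := B) i) := by
  refine ⟨fun d X hX => ?_, fun X => ?_⟩
  · have : idTensor (Fin d) (keepSlot i) X =
        ∑ y, X.submatrix (fun p : Fin d × B => (p.1, (Equiv.funSplitAt i B).symm (p.2, y)))
          (fun p : Fin d × B => (p.1, (Equiv.funSplitAt i B).symm (p.2, y))) := by
      ext p q
      simp only [idTensor, of_apply, keepSlot_apply, Matrix.sum_apply, submatrix_apply]
    rw [this]
    exact posSemidef_sum _ fun y _ => hX.submatrix _
  · simp only [Matrix.trace, diag_apply, keepSlot_apply]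
    rw [← Fintype.sum_prod_type']
    exact (Equiv.funSplitAt i B).symm.sum_comp fun x => X x x

end Channels

/-! ### Position-based encoding -/

section PositionBased

set_option linter.unusedSectionVars false

variable {K : ℕ} {M : Fin K → ℕ} {S B : Fin K → Type*} {D : Type*}
  [∀ k, Fintype (S k)] [∀ k, DecidableEq (S k)] [∀ k, Fintype (B k)] [∀ k, DecidableEq (B k)]
  [Fintype D] [DecidableEq D]

/-- The state of the receiver after position-based encoding of the message tuple `m`: the operator
`ω` on the `m_k`-th copies of the `S_k` together with `D`, and `θ_k` on the other copies. -/
def messageState (m : ∀ k, Fin (M k)) (θ : ∀ k, Matrix (S k) (S k) ℂ)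
    (ω : Matrix ((∀ k, S k) × D) ((∀ k, S k) × D) ℂ) :
    Matrix ((∀ k, Fin (M k) → S k) × D) ((∀ k, Fin (M k) → S k) × D) ℂ :=
  Matrix.of fun p q => (∏ k, ∏ i, if i = m k then 1 else θ k (p.1 k i) (q.1 k i)) *
    ω (fun k => p.1 k (m k), p.2) (fun k => q.1 k (m k), q.2)

/-- The all-ones matrix is neutral for entrywise products, so it can fill the slots of the chosen
copies, whose entries are supplied by `ω`. -/
lemma ones_posSemidef {X : Type*} [Fintype X] :
    (Matrix.of fun _ _ : X => (1 : ℂ)).PosSemidef := by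
  have : (Matrix.of fun _ _ : X => (1 : ℂ)) = vecMulVec (fun _ => 1) (star fun _ => 1) := by
    ext; simp [vecMulVec_apply]
  rw [this]
  exact posSemidef_vecMulVec_self_star _

lemma messageState_posSemidef (m : ∀ k, Fin (M k)) {θ : ∀ k, Matrix (S k) (S k) ℂ}
    (hθ : ∀ k, (θ k).PosSemidef) {ω : Matrix ((∀ k, S k) × D) ((∀ k, S k) × D) ℂ}
    (hω : ω.PosSemidef) : (messageState m θ ω).PosSemidef := by
  -- Along an index map that duplicates the chosen copies, a submatrix of a Kronecker product is an
  -- entrywise product, so positivity is inherited.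
  have h : messageState m θ ω =
      ((piTensor fun k => piTensor fun i : Fin (M k) =>
        if i = m k then Matrix.of fun _ _ => 1 else θ k) ⊗ₖ ω).submatrix
        (fun p => (p.1, (fun k => p.1 k (m k), p.2)))
        (fun p => (p.1, (fun k => p.1 k (m k), p.2))) := by
    ext p q
    simp only [messageState, of_apply, submatrix_apply, kroneckerMap_apply, piTensor]
    congr 1
    refine Finset.prod_congr rfl fun k _ => Finset.prod_congr rfl fun i _ => ?_
    split_ifs <;> rfl
  rw [h]
  refine ((piTensor_posSemidef fun k => piTensor_posSemidef fun i => ?_).kronecker hω).submatrix _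
  split_ifs
  · exact ones_posSemidef
  · exact hθ k

lemma checkOperator_eq_messageState (T : Matrix ((∀ k, S k) × D) ((∀ k, S k) × D) ℂ)
    (m : ∀ k, Fin (M k)) : checkOperator T m = messageState m (fun _ => 1) T := by
  ext p q
  simp only [checkOperator, messageState, of_apply, one_apply]
  split_ifs with h
  · rw [Finset.prod_eq_one fun k _ => Finset.prod_eq_one fun i _ => ?_, one_mul]
    split_ifs with h1 h2
    · rfl
    · rfl
    · exact absurd (h k i h1) h2
  · push Not at h
    obtain ⟨k, i, hi, hne⟩ := h
    rw [Finset.prod_eq_zero (Finset.mem_univ k), zero_mul]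
    exact Finset.prod_eq_zero (Finset.mem_univ i) (by simp [hi, hne])

lemma checkOperator_posSemidef {T : Matrix ((∀ k, S k) × D) ((∀ k, S k) × D) ℂ}
    (hT : T.PosSemidef) (m : ∀ k, Fin (M k)) : (checkOperator T m).PosSemidef := by
  rw [checkOperator_eq_messageState]
  exact messageState_posSemidef m (fun k => PosSemidef.one) hT

lemma one_sub_checkOperator (T : Matrix ((∀ k, S k) × D) ((∀ k, S k) × D) ℂ)
    (m : ∀ k, Fin (M k)) : 1 - checkOperator T m = checkOperator (1 - T) m := by
  ext p q
  simp only [checkOperator, of_apply, Matrix.sub_apply, one_apply]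
  by_cases h : ∀ k i, i ≠ m k → p.1 k i = q.1 k i
  · rw [if_pos h, if_pos h]
    congr 2
    refine propext ⟨fun e => by rw [e], fun e => ?_⟩
    obtain ⟨e1, e2⟩ := Prod.mk.inj e
    refine Prod.ext (funext fun k => funext fun i => ?_) e2
    by_cases hi : i = m k
    · subst hi; exact congrFun e1 k
    · exact h k i hi
  · rw [if_neg h, if_neg h, if_neg, sub_zero]
    rintro rfl
    exact h fun _ _ _ => rfl

lemma checkOperator_le_one {T : Matrix ((∀ k, S k) × D) ((∀ k, S k) × D) ℂ}
    (hT : (1 - T).PosSemidef) (m : ∀ k, Fin (M k)) : checkOperator T m ≤ 1 := by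
  rw [Matrix.le_iff, one_sub_checkOperator]
  exact checkOperator_posSemidef hT m

/-- The copies not sent lose their `B` parts to the partial trace and become marginals; only copy
`i` keeps both halves. -/
lemma idTensor_keepSlot_tensorBipartite {S B ι : Type*} [Fintype S] [DecidableEq S] [Fintype B]
    [DecidableEq B] [Fintype ι] [DecidableEq ι] (i : ι) (Θ : Matrix (S × B) (S × B) ℂ)
    (p q : (ι → S) × B) :
    idTensor (ι → S) (keepSlot i) (tensorBipartite fun _ : ι => Θ) p q =
      (∏ j, if j = i then 1 else traceRight Θ (p.1 j) (q.1 j)) *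
        Θ (p.1 i, p.2) (q.1 i, q.2) := by
  simp only [idTensor, of_apply, keepSlot_apply, tensorBipartite]
  have h : ∀ y : {j // j ≠ i} → B, (∏ k, Θ
      (p.1 k, (Equiv.funSplitAt i B).symm (p.2, y) k)
      (q.1 k, (Equiv.funSplitAt i B).symm (q.2, y) k)) =
      Θ (p.1 i, p.2) (q.1 i, q.2) * ∏ k : {j // j ≠ i}, Θ (p.1 k, y k) (q.1 k, y k) := by
    intro y
    rw [Fintype.prod_eq_mul_prod_subtype_ne _ i]
    congr 1
    · simp
    · refine Finset.prod_congr (Finset.ext fun _ => by simp) fun k _ => ?_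
      simp [k.2]
  simp only [h]
  rw [← Finset.mul_sum, mul_comm]
  congr 1
  rw [Fintype.prod_eq_mul_prod_subtype_ne _ i, if_pos rfl, one_mul]
  have := sum_prod_eq_prod_sum (fun (k : {j // j ≠ i}) (y : B) => Θ (p.1 k, y) (q.1 k, y))
  rw [this]
  refine Finset.prod_congr rfl fun k _ => ?_
  rw [if_neg k.2]; rfl

lemma idTensor_tensorBipartite_keepSlot (Φ : Matrix (∀ k, B k) (∀ k, B k) ℂ →ₗ[ℂ] Matrix D D ℂ)
    (Θ : ∀ k, Matrix (S k × B k) (S k × B k) ℂ) (m : ∀ k, Fin (M k)) :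
    idTensor (∀ k, Fin (M k) → S k) Φ (tensorBipartite fun k =>
      idTensor (Fin (M k) → S k) (keepSlot (m k)) (tensorBipartite fun _ : Fin (M k) => Θ k)) =
    messageState m (fun k => traceRight (Θ k)) (idTensor (∀ k, S k) Φ (tensorBipartite Θ)) := by
  ext p q
  have h : (Matrix.of fun a a' : ∀ k, B k =>
      (tensorBipartite (R := fun k => Fin (M k) → S k) (A := B) fun k =>
      idTensor (Fin (M k) → S k) (keepSlot (m k)) (tensorBipartite fun _ : Fin (M k) => Θ k))
        (p.1, a) (q.1, a')) =
      (∏ k, ∏ i, if i = m k then 1 else traceRight (Θ k) (p.1 k i) (q.1 k i)) •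
      Matrix.of fun a a' : ∀ k, B k => tensorBipartite Θ (fun k => p.1 k (m k), a)
        (fun k => q.1 k (m k), a') := by
    ext a a'
    change (∏ k, idTensor (Fin (M k) → S k) (keepSlot (m k))
        (tensorBipartite fun _ : Fin (M k) => Θ k) (p.1 k, a k) (q.1 k, a' k)) =
      (∏ k, ∏ i, if i = m k then 1 else traceRight (Θ k) (p.1 k i) (q.1 k i)) *
        ∏ k, Θ k (p.1 k (m k), a k) (q.1 k (m k), a' k)
    rw [← Finset.prod_mul_distrib]
    exact Finset.prod_congr rfl fun k _ => idTensor_keepSlot_tensorBipartite (m k) (Θ k) _ _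
  simp only [idTensor, of_apply, messageState] at h ⊢
  rw [h, map_smul]
  rfl

/-- The state `⊗_{j ∈ J} θ_j ⊗ Tr_{S(J)} ω`, every system being in its place. -/
def crossState (J : Finset (Fin K)) (θ : ∀ k, Matrix (S k) (S k) ℂ)
    (ω : Matrix ((∀ k, S k) × D) ((∀ k, S k) × D) ℂ) :
    Matrix ((∀ k, S k) × D) ((∀ k, S k) × D) ℂ :=
  ((piTensor fun k : {k // k ∈ J} => θ k) ⊗ₖ marginalCompl J ω).submatrix
    (fun p => (fun k => p.1 k, (fun k => p.1 k, p.2)))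
    (fun p => (fun k => p.1 k, (fun k => p.1 k, p.2)))

/-- The indicators make the dependence on `J` a product over senders, whose factors are exactly the
values computed in `sum_prod_slots`. -/
lemma crossState_apply (J : Finset (Fin K)) (θ : ∀ k, Matrix (S k) (S k) ℂ)
    (ω : Matrix ((∀ k, S k) × D) ((∀ k, S k) × D) ℂ) (y x : (∀ k, S k) × D) :
    crossState J θ ω y x = ∑ v', ∑ v, ω (v', y.2) (v, x.2) *
      ∏ k, if k ∈ J then θ k (y.1 k) (x.1 k) * (if v' k = v k then 1 else 0)
        else (if v' k = y.1 k then 1 else 0) * (if v k = x.1 k then 1 else 0) := by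
  simp only [← (Equiv.piEquivPiSubtypeProd (· ∈ J) S).symm.sum_comp, Fintype.sum_prod_type]
  have h : ∀ (t t' : ∀ k : {k // k ∈ J}, S k) (s s' : ∀ k : {k // k ∉ J}, S k),
      (∏ k, if k ∈ J then θ k (y.1 k) (x.1 k) *
        (if (Equiv.piEquivPiSubtypeProd (· ∈ J) S).symm (t', s') k =
          (Equiv.piEquivPiSubtypeProd (· ∈ J) S).symm (t, s) k then (1 : ℂ) else 0)
        else (if (Equiv.piEquivPiSubtypeProd (· ∈ J) S).symm (t', s') k = y.1 k then 1 else 0) *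
          (if (Equiv.piEquivPiSubtypeProd (· ∈ J) S).symm (t, s) k = x.1 k then 1 else 0)) =
      (∏ k : {k // k ∈ J}, θ k (y.1 k) (x.1 k)) * (if t' = t then 1 else 0) *
        ((if s' = (fun k : {k // k ∉ J} => y.1 k) then 1 else 0) * (if s = (fun k : {k // k ∉ J} => x.1 k) then 1 else 0)) := by
    intro t t' s s'
    rw [← Fintype.prod_subtype_mul_prod_subtype (· ∈ J), ← prod_ite_eq_one t' t,
      ← prod_ite_eq_one s', ← prod_ite_eq_one s, ← Finset.prod_mul_distrib,
      ← Finset.prod_mul_distrib]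
    congr 1
    · refine Finset.prod_congr (Finset.ext fun _ => by simp) fun k _ => ?_
      simp [k.2]
    · refine Finset.prod_congr (Finset.ext fun _ => by simp) fun k _ => ?_
      simp [k.2]
  simp only [h]
  simp only [crossState, submatrix_apply, kroneckerMap_apply, piTensor, of_apply, marginalCompl,
    Finset.mul_sum, mul_ite, mul_one, mul_zero, Finset.sum_ite_eq, Finset.sum_ite_eq',
    Finset.mem_univ, if_true, Finset.sum_ite_irrel, Finset.sum_const_zero]
  exact Finset.sum_congr rfl fun t _ => mul_comm _ _

/-- One sender's contribution to the overlap of a check operator with a message state. -/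
lemma sum_prod_slots {S : Type*} [Fintype S] [DecidableEq S] {M : ℕ} (m m' : Fin M)
    {θ : Matrix S S ℂ} (hθ : θ.trace = 1) (u u' v v' : S) :
    ∑ a : Fin M → S, ∑ b : Fin M → S, ∏ i,
      ((if i = m' then (if u = a i then 1 else 0) * (if u' = b i then 1 else 0)
          else if a i = b i then 1 else 0) *
        (if i = m then (if v = a i then 1 else 0) * (if v' = b i then 1 else 0)
          else θ (b i) (a i))) =
    if m ≠ m' then θ u' u * (if v' = v then 1 else 0)
      else (if v' = u' then 1 else 0) * (if v = u then 1 else 0) := by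
  have htr : ∑ a, θ a a = 1 := hθ
  set h : Fin M → S → S → ℂ := fun i a b =>
    ((if i = m' then (if u = a then 1 else 0) * (if u' = b then 1 else 0)
          else if a = b then 1 else 0) *
        (if i = m then (if v = a then 1 else 0) * (if v' = b then 1 else 0)
          else θ b a)) with hh
  have e1 : (∑ a : Fin M → S, ∑ b : Fin M → S, ∏ i, h i (a i) (b i)) =
      ∏ i, ∑ a, ∑ b, h i a b := by
    rw [← sum_prod_eq_prod_sum]
    exact Finset.sum_congr rfl fun a _ => sum_prod_eq_prod_sum fun i b => h i (a i) b
  refine e1.trans ?_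
  -- A slot chosen by neither tuple pairs the identity with `θ` and contributes `Tr θ = 1`.
  have e2 : ∀ i, i ≠ m → i ≠ m' → ∑ a, ∑ b, h i a b = 1 := by
    intro i h1 h2
    simp [hh, h1, h2, htr]
  by_cases hmm : m = m'
  · subst hmm
    rw [Finset.prod_eq_single m (fun i _ hi => e2 i hi hi) (by simp), if_neg (by simp)]
    have : ∀ a b, h m a b = (if v' = b then (if u' = b then 1 else 0) else 0) *
        (if v = a then (if u = a then 1 else 0) else 0) := by
      intro a b
      simp only [hh, if_true]
      split_ifs <;> simp
    simp only [this, ← Finset.mul_sum, ← Finset.sum_mul, Finset.sum_ite_eq, Finset.mem_univ,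
      if_true]
    simp only [eq_comm]
  · rw [Finset.prod_eq_mul m' m (Ne.symm hmm) (fun i _ hi => e2 i hi.2 hi.1) (by simp) (by simp),
      if_pos hmm]
    congr 1
    · simp only [hh, if_true, if_neg (Ne.symm hmm), ite_mul, mul_ite, one_mul, zero_mul, mul_one,
        mul_zero, Finset.sum_ite_eq, Finset.mem_univ, if_true]
    · simp only [hh, if_true, if_neg hmm]
      simp [eq_comm]

lemma sum_reorder {P C U : Type*} [Fintype P] [Fintype C] [Fintype U]
    (f : P → C → P → C → U → U → U → U → ℂ) :
    ∑ p, ∑ c, ∑ q, ∑ c', ∑ u, ∑ u', ∑ v', ∑ v, f p c q c' u u' v' v =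
      ∑ u, ∑ c, ∑ u', ∑ c', ∑ v', ∑ v, ∑ p, ∑ q, f p c q c' u u' v' v := by
  simp only [← Fintype.sum_prod_type']
  exact Fintype.sum_equiv
    ⟨fun ⟨p, c, q, c', u, u', v', v⟩ => ⟨u, c, u', c', v', v, p, q⟩,
    fun ⟨u, c, u', c', v', v, p, q⟩ => ⟨p, c, q, c', u, u', v', v⟩,
    fun _ => rfl, fun _ => rfl⟩ _ _ fun _ => rfl

/-- The overlap of a check operator with a message state. -/
lemma trace_checkOperator_mul_messageState (T : Matrix ((∀ k, S k) × D) ((∀ k, S k) × D) ℂ)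
    (m m' : ∀ k, Fin (M k)) {θ : ∀ k, Matrix (S k) (S k) ℂ} (hθ : ∀ k, (θ k).trace = 1)
    (ω : Matrix ((∀ k, S k) × D) ((∀ k, S k) × D) ℂ) :
    (checkOperator T m' * messageState m θ ω).trace =
      (T * crossState (Finset.univ.filter fun k => m k ≠ m' k) θ ω).trace := by
  -- The entries of `T` and `ω` couple all the senders. Free indices `u, u'` for `T` and `v, v'` for
  -- `ω`, tied to the copies by indicators, make the remaining sum factor over senders and slots.
  let h : ∀ (_ _ _ _ : ∀ k, S k) (k : Fin K) (_ _ : Fin (M k) → S k) (_ : Fin (M k)), ℂ :=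
    fun u u' v v' k a b i =>
      ((if i = m' k then (if u k = a i then 1 else 0) * (if u' k = b i then 1 else 0)
          else if a i = b i then 1 else 0) *
        (if i = m k then (if v k = a i then 1 else 0) * (if v' k = b i then 1 else 0)
          else θ k (b i) (a i)))
  have hterm : ∀ (p q : ∀ k, Fin (M k) → S k) (c c' : D),
      checkOperator T m' (p, c) (q, c') * messageState m θ ω (q, c') (p, c) =
      ∑ u, ∑ u', ∑ v', ∑ v, T (u, c) (u', c') * (ω (v', c') (v, c) *
        ∏ k, ∏ i, h u u' v v' k (p k) (q k) i) := by
    intro p q c c'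
    have hprod : ∀ u u' v v', (∏ k, ∏ i, h u u' v v' k (p k) (q k) i) =
        if u = (fun k => p k (m' k)) then if u' = (fun k => q k (m' k)) then
          if v' = (fun k => q k (m k)) then if v = (fun k => p k (m k)) then
            if ∀ k i, i ≠ m' k → p k i = q k i then
              ∏ k, ∏ i, (if i = m k then 1 else θ k (q k i) (p k i))
            else 0 else 0 else 0 else 0 else 0 := by
      intro u u' v v'
      have hz : ∀ k i, h u u' v v' k (p k) (q k) i = 0 →
          (∏ k, ∏ i, h u u' v v' k (p k) (q k) i) = 0 := fun k i hki =>
        Finset.prod_eq_zero (Finset.mem_univ k) (Finset.prod_eq_zero (Finset.mem_univ i) hki)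
      split_ifs with h1 h2 h3 h4 h5
      · subst h1 h2 h3 h4
        refine Finset.prod_congr rfl fun k _ => Finset.prod_congr rfl fun i _ => ?_
        have : i ≠ m' k → p k i = q k i := h5 k i
        by_cases hi : i = m' k
        · rw [hi]
          by_cases hj : m' k = m k
          · simp [h, hj]
          · simp [h, hj]
        · by_cases hj : i = m k
          · rw [if_pos hj]
            simp only [h, if_neg hi, if_pos (this hi), one_mul, if_pos hj]
            simp [hj]
          · simp only [h, if_neg hi, if_pos (this hi), one_mul, if_neg hj]
      · push Not at h5
        obtain ⟨k, i, hi, hne⟩ := h5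
        exact hz k i (by simp [h, hi, hne])
      · obtain ⟨k, hk⟩ := Function.ne_iff.mp h4
        exact hz k (m k) (by simp [h, hk])
      · obtain ⟨k, hk⟩ := Function.ne_iff.mp h3
        exact hz k (m k) (by simp [h, hk])
      · obtain ⟨k, hk⟩ := Function.ne_iff.mp h2
        exact hz k (m' k) (by simp [h, hk])
      · obtain ⟨k, hk⟩ := Function.ne_iff.mp h1
        exact hz k (m' k) (by simp [h, hk])
    simp only [hprod, mul_ite, mul_zero, Finset.sum_ite_irrel, Finset.sum_const_zero,
      Finset.sum_ite_eq', Finset.mem_univ, if_true]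
    simp only [checkOperator, messageState, of_apply]
    split_ifs
    · ring
    · simp
  have hL : (checkOperator T m' * messageState m θ ω).trace =
      ∑ p, ∑ c, ∑ q, ∑ c', checkOperator T m' (p, c) (q, c') *
        messageState m θ ω (q, c') (p, c) := by
    simp only [Matrix.trace, diag_apply, mul_apply, Fintype.sum_prod_type]
  have hR : (T * crossState (Finset.univ.filter fun k => m k ≠ m' k) θ ω).trace =
      ∑ u, ∑ c, ∑ u', ∑ c', T (u, c) (u', c') *
        crossState (Finset.univ.filter fun k => m k ≠ m' k) θ ω (u', c') (u, c) := by
    simp only [Matrix.trace, diag_apply, mul_apply, Fintype.sum_prod_type]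
  have hF : ∀ u u' v v', (∑ p : ∀ k, Fin (M k) → S k, ∑ q : ∀ k, Fin (M k) → S k,
      ∏ k, ∏ i, h u u' v v' k (p k) (q k) i) =
      ∏ k, if k ∈ (Finset.univ.filter fun k => m k ≠ m' k) then
        θ k (u' k) (u k) * (if v' k = v k then 1 else 0)
        else (if v' k = u' k then 1 else 0) * (if v k = u k then 1 else 0) := by
    intro u u' v v'
    have e1 : (∑ p : ∀ k, Fin (M k) → S k, ∑ q : ∀ k, Fin (M k) → S k,
      ∏ k, ∏ i, h u u' v v' k (p k) (q k) i) =
        ∏ k, ∑ a, ∑ b, ∏ i, h u u' v v' k a b i := by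
      rw [← sum_prod_eq_prod_sum]
      exact Finset.sum_congr rfl fun p _ =>
        sum_prod_eq_prod_sum fun k b => ∏ i, h u u' v v' k (p k) b i
    rw [e1]
    refine Finset.prod_congr rfl fun k _ => ?_
    simp only [Finset.mem_filter, Finset.mem_univ, true_and]
    exact sum_prod_slots (m k) (m' k) (hθ k) (u k) (u' k) (v k) (v' k)
  rw [hL, hR]
  simp only [hterm, crossState_apply, ← hF, Finset.mul_sum]
  exact sum_reorder _

end PositionBased

/-! ### The one-shot coding theorem -/

section OneShot

set_option linter.unusedSectionVars false

variable {K : ℕ} {M : Fin K → ℕ} {S B : Fin K → Type*} {D : Type*}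
  [∀ k, Fintype (S k)] [∀ k, DecidableEq (S k)] [∀ k, Fintype (B k)] [∀ k, DecidableEq (B k)]
  [Fintype D] [DecidableEq D]

/-- This is the case of the correct tuple, which gives the first kind of error. -/
lemma crossState_empty (θ : ∀ k, Matrix (S k) (S k) ℂ)
    (ω : Matrix ((∀ k, S k) × D) ((∀ k, S k) × D) ℂ) : crossState ∅ θ ω = ω := by
  ext y x
  rw [crossState_apply]
  simp only [Finset.notMem_empty, if_false, Finset.prod_mul_distrib, prod_ite_eq_one]
  simp only [mul_ite, mul_one, mul_zero, Finset.sum_ite_eq',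
    Finset.mem_univ, if_true]

/-- The square-root measurement built from the check operators of a test `T`. -/
def squareRootPOVM (M : Fin K → ℕ) (T : Matrix ((∀ k, S k) × D) ((∀ k, S k) × D) ℂ) :
    Option (∀ k, Fin (M k)) →
      Matrix ((∀ k, Fin (M k) → S k) × D) ((∀ k, Fin (M k) → S k) × D) ℂ
  | some m => invSqrt (∑ m' : ∀ k, Fin (M k), checkOperator T m') * checkOperator T m *
      invSqrt (∑ m' : ∀ k, Fin (M k), checkOperator T m')
  | none => 1 - ∑ m : ∀ k, Fin (M k), invSqrt (∑ m' : ∀ k, Fin (M k), checkOperator T m') *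
      checkOperator T m * invSqrt (∑ m' : ∀ k, Fin (M k), checkOperator T m')

lemma squareRootPOVM_posSemidef (M : Fin K → ℕ)
    {T : Matrix ((∀ k, S k) × D) ((∀ k, S k) × D) ℂ} (hT : T.PosSemidef)
    (o : Option (∀ k, Fin (M k))) : (squareRootPOVM M T o).PosSemidef := by
  have hG : (∑ m' : ∀ k, Fin (M k), checkOperator T m').PosSemidef :=
    posSemidef_sum _ fun m _ => checkOperator_posSemidef hT m
  cases o with
  | some m =>
    have := (checkOperator_posSemidef hT m).mul_mul_conjTranspose_same
      (invSqrt (∑ m' : ∀ k, Fin (M k), checkOperator T m'))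
    rwa [invSqrt_conjTranspose hG] at this
  | none =>
    simp only [squareRootPOVM]
    -- The message outcomes add up to `G^{-1/2} G G^{-1/2}`, which is at most `1`.
    rw [← Finset.sum_mul, ← Finset.mul_sum]
    exact Matrix.le_iff.mp (invSqrt_mul_self_mul_invSqrt_le_one hG)

lemma squareRootPOVM_sum (M : Fin K → ℕ) (T : Matrix ((∀ k, S k) × D) ((∀ k, S k) × D) ℂ) :
    ∑ o, squareRootPOVM M T o = 1 := by
  rw [Fintype.sum_option]
  exact sub_add_cancel _ _

/-- The position-based code with the simultaneous decoder given by the test `T`. -/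
def positionBasedCode (M : Fin K → ℕ) {Θ : ∀ k, Matrix (S k × B k) (S k × B k) ℂ}
    (hΘ : ∀ k, IsState (Θ k)) {T : Matrix ((∀ k, S k) × D) ((∀ k, S k) × D) ℂ}
    (hT : T.PosSemidef) :
    EACode M (fun k => Fin (M k) → S k) (fun k => Fin (M k) → B k) B D where
  shared := fun k => tensorBipartite fun _ : Fin (M k) => Θ k
  shared_isState := fun k => IsState.tensorBipartite fun _ => hΘ k
  encoder := fun _ m => keepSlot m
  encoder_isChannel := fun _ m => keepSlot_isChannel m
  povm := squareRootPOVM M T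
  povm_posSemidef := squareRootPOVM_posSemidef M hT
  povm_sum := squareRootPOVM_sum M T

/-- Each sender in `J` has `M j - 1` wrong messages, and every other entry is forced. Keeping the
`-1` later absorbs the rounding of the `M j`. -/
lemma card_differingSlots (m : ∀ k, Fin (M k)) (J : Finset (Fin K)) :
    (Finset.univ.filter fun m' : ∀ k, Fin (M k) =>
      (Finset.univ.filter fun k => m k ≠ m' k) = J).card = ∏ j ∈ J, (M j - 1) := by
  have : (Finset.univ.filter fun m' : ∀ k, Fin (M k) =>
      (Finset.univ.filter fun k => m k ≠ m' k) = J) =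
      Fintype.piFinset fun k => if k ∈ J then Finset.univ.erase (m k) else {m k} := by
    ext m'
    simp only [Finset.mem_filter, Finset.mem_univ, true_and, Fintype.mem_piFinset, Finset.ext_iff]
    refine forall_congr' fun k => ?_
    split_ifs with h
    · simp [h, eq_comm]
    · simp [h, eq_comm]
  rw [this, Fintype.card_piFinset, Finset.prod_congr rfl fun k _ => apply_ite Finset.card _ _ _]
  simp

/-- Wrong tuples are grouped by the set of senders at which they are wrong; removing `m` removes
exactly the empty set. -/
lemma sum_ne_differingSlots (m : ∀ k, Fin (M k)) (g : Finset (Fin K) → ℝ) :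
    ∑ m' ∈ Finset.univ.erase m, g (Finset.univ.filter fun k => m k ≠ m' k) =
      ∑ J ∈ Finset.univ.filter Finset.Nonempty, (∏ j ∈ J, (M j - 1) : ℕ) * g J := by
  rw [← Finset.sum_fiberwise_of_maps_to (s := Finset.univ.erase m)
    (t := Finset.univ.filter Finset.Nonempty)
    (g := fun m' : ∀ k, Fin (M k) => Finset.univ.filter fun k => m k ≠ m' k)]
  · refine Finset.sum_congr rfl fun J hJ => ?_
    rw [Finset.sum_congr rfl fun m' hm' => by rw [(Finset.mem_filter.mp hm').2], Finset.sum_const,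
      nsmul_eq_mul, ← card_differingSlots m J]
    congr 3
    ext m'
    simp only [Finset.mem_filter, Finset.mem_erase, Finset.mem_univ, and_true, true_and,
      and_iff_right_iff_imp]
    rintro h rfl
    have hJ' := (Finset.mem_filter.mp hJ).2
    rw [← h] at hJ'
    simp at hJ'
  · intro m' hm'
    obtain ⟨k, hk⟩ := Function.ne_iff.mp (Finset.ne_of_mem_erase hm')
    simp only [Finset.mem_filter, Finset.mem_univ, true_and]
    exact ⟨k, by simpa using Ne.symm hk⟩

/-- Hayashi–Nagaoka is applied to the correct check operator against the sum of all others. The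
resulting bound does not depend on `m`, so it also bounds the average. -/
lemma errorProb_positionBasedCode_le {Θ : ∀ k, Matrix (S k × B k) (S k × B k) ℂ}
    (hΘ : ∀ k, IsState (Θ k)) {T : Matrix ((∀ k, S k) × D) ((∀ k, S k) × D) ℂ}
    (hT : T.PosSemidef) (hT1 : (1 - T).PosSemidef)
    {Φ : Matrix (∀ k, B k) (∀ k, B k) ℂ →ₗ[ℂ] Matrix D D ℂ}
    (hω : (idTensor (∀ k, S k) Φ (tensorBipartite Θ)).PosSemidef) (m : ∀ k, Fin (M k)) :
    (positionBasedCode M hΘ hT).errorProb Φ m ≤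
      2 * ((1 - T) * idTensor (∀ k, S k) Φ (tensorBipartite Θ)).trace.re +
      4 * ∑ J ∈ Finset.univ.filter Finset.Nonempty, (∏ j ∈ J, (M j - 1) : ℕ) *
        (T * crossState J (fun k => traceRight (Θ k))
          (idTensor (∀ k, S k) Φ (tensorBipartite Θ))).trace.re := by
  set ω := idTensor (∀ k, S k) Φ (tensorBipartite Θ) with hωdef
  set θ : ∀ k, Matrix (S k) (S k) ℂ := fun k => traceRight (Θ k) with hθdef
  have hθ : ∀ k, IsState (θ k) := fun k => (hΘ k).traceRight
  have hρ : (messageState m θ ω).PosSemidef := messageState_posSemidef m (fun k => (hθ k).1) hω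
  have herr : (positionBasedCode M hΘ hT).errorProb Φ m =
      ((1 - squareRootPOVM M T (some m)) * messageState m θ ω).trace.re := by
    rw [hωdef, hθdef, ← idTensor_tensorBipartite_keepSlot]
    rfl
  have hsum : ∑ m' : ∀ k, Fin (M k), checkOperator T m' =
      checkOperator T m + ∑ m' ∈ Finset.univ.erase m, checkOperator T m' :=
    (Finset.add_sum_erase _ _ (Finset.mem_univ m)).symm
  have hrest : (∑ m' ∈ Finset.univ.erase m, checkOperator T m').PosSemidef :=
    posSemidef_sum _ fun m' _ => checkOperator_posSemidef hT m'
  have hHN := hayashi_nagaoka (checkOperator_posSemidef hT m) (checkOperator_le_one hT1 m) hrest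
  rw [← hsum] at hHN
  rw [herr]
  refine (re_trace_mul_le_left hHN hρ).trans (le_of_eq ?_)
  have e1 : ((1 - checkOperator T m) * messageState m θ ω).trace = ((1 - T) * ω).trace := by
    rw [one_sub_checkOperator, trace_checkOperator_mul_messageState _ _ _ fun k => (hθ k).2]
    simp [crossState_empty]
  have e2 : ((∑ m' ∈ Finset.univ.erase m, checkOperator T m') * messageState m θ ω).trace.re =
      ∑ J ∈ Finset.univ.filter Finset.Nonempty, (∏ j ∈ J, (M j - 1) : ℕ) *
        (T * crossState J θ ω).trace.re := by
    rw [← sum_ne_differingSlots m fun J => (T * crossState J θ ω).trace.re, Finset.sum_mul,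
      Matrix.trace_sum, Complex.re_sum]
    refine Finset.sum_congr rfl fun m' _ => ?_
    rw [trace_checkOperator_mul_messageState _ _ _ fun k => (hθ k).2]
  rw [Matrix.add_mul, Matrix.trace_add, Matrix.smul_mul, Matrix.smul_mul, Matrix.trace_smul,
    Matrix.trace_smul, e1, Complex.add_re, ← e2]
  simp

/-- A test `T` with a bound on its two kinds of error yields a code. -/
lemma avgErrorProb_positionBasedCode_le (hM : ∀ k, 0 < M k)
    {Θ : ∀ k, Matrix (S k × B k) (S k × B k) ℂ}
    (hΘ : ∀ k, IsState (Θ k)) {T : Matrix ((∀ k, S k) × D) ((∀ k, S k) × D) ℂ}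
    (hT : T.PosSemidef) (hT1 : (1 - T).PosSemidef)
    {Φ : Matrix (∀ k, B k) (∀ k, B k) ℂ →ₗ[ℂ] Matrix D D ℂ}
    (hω : (idTensor (∀ k, S k) Φ (tensorBipartite Θ)).PosSemidef) {e₁ e₂ : ℝ}
    (h1 : ((1 - T) * idTensor (∀ k, S k) Φ (tensorBipartite Θ)).trace.re ≤ e₁)
    (h2 : ∀ J : Finset (Fin K), J.Nonempty → (∏ j ∈ J, (M j - 1) : ℕ) *
        (T * crossState J (fun k => traceRight (Θ k))
          (idTensor (∀ k, S k) Φ (tensorBipartite Θ))).trace.re ≤ e₂) (he₂ : 0 ≤ e₂) :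
    (positionBasedCode M hΘ hT).avgErrorProb Φ ≤ 2 * e₁ + 4 * (2 ^ K * e₂) := by
  have hpos : (0 : ℝ) < ∏ k, (M k : ℝ) := Finset.prod_pos fun k _ => by exact_mod_cast hM k
  rw [EACode.avgErrorProb, div_le_iff₀ hpos]
  refine (Finset.sum_le_sum fun m _ => (errorProb_positionBasedCode_le hΘ hT hT1 hω m).trans
    (add_le_add (mul_le_mul_of_nonneg_left h1 zero_le_two) (mul_le_mul_of_nonneg_left
      (Finset.sum_le_sum fun J hJ => h2 J (Finset.mem_filter.mp hJ).2) zero_le_four))).trans ?_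
  have hcard : ((Finset.univ.filter (Finset.Nonempty (α := Fin K))).card : ℝ) ≤ 2 ^ K := by
    have := Finset.card_filter_le (Finset.univ : Finset (Finset (Fin K))) Finset.Nonempty
    rw [Finset.card_univ, Fintype.card_finset, Fintype.card_fin] at this
    exact_mod_cast this
  rw [Finset.sum_const, Finset.sum_const, nsmul_eq_mul, nsmul_eq_mul, mul_comm]
  have e : ((Finset.univ : Finset (∀ k, Fin (M k))).card : ℝ) = ∏ k, (M k : ℝ) := by
    simp
  rw [e]
  gcongr

end OneShot

/-! ### Many uses of the channel -/

section ManyUses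

set_option linter.unusedSectionVars false

variable {K : ℕ} {S A : Fin K → Type*} {C : Type*}
  [∀ k, Fintype (S k)] [∀ k, DecidableEq (S k)] [∀ k, Fintype (A k)] [∀ k, DecidableEq (A k)]
  [Fintype C] [DecidableEq C]

/-- Regrouping of `n` copies of `(⊗_k S_k) ⊗ C`, by copies on the one side and by systems on the
other. -/
def regroup {κ : Type*} (S : κ → Type*) (C : Type*) (n : ℕ) :
    (∀ k, Fin n → S k) × (Fin n → C) ≃ (Fin n → (∀ k, S k) × C) where
  toFun p t := (fun k => p.1 k t, p.2 t)
  invFun x := (fun k t => (x t).1 k, fun t => (x t).2)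
  left_inv _ := rfl
  right_inv _ := rfl

lemma map_eq_sum_single {X Y : Type*} [Fintype X] [DecidableEq X]
    (Φ : Matrix X X ℂ →ₗ[ℂ] Matrix Y Y ℂ) (Z : Matrix X X ℂ) (c c' : Y) :
    Φ Z c c' = ∑ a, ∑ a', Z a a' * Φ (Matrix.single a a' 1) c c' := by
  conv_lhs => rw [matrix_eq_sum_single Z]
  simp only [map_sum, Matrix.sum_apply]
  refine Finset.sum_congr rfl fun a _ => Finset.sum_congr rfl fun a' _ => ?_
  have : Matrix.single a a' (Z a a') = Z a a' • Matrix.single a a' (1 : ℂ) := by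
    rw [smul_single]; simp
  rw [this, map_smul, Matrix.smul_apply, smul_eq_mul]

/-- Expansion in matrix units turns both sides into sums of products over channel uses; only the
grouping, by sender or by use, differs. -/
lemma idTensor_channelPow (N : Matrix (∀ k, A k) (∀ k, A k) ℂ →ₗ[ℂ] Matrix C C ℂ)
    (θ : ∀ k, Matrix (S k × A k) (S k × A k) ℂ) (n : ℕ) :
    idTensor (∀ k, Fin n → S k) (channelPow N n)
      (tensorBipartite fun k => tensorBipartite fun _ : Fin n => θ k) =
    (piTensor fun _ : Fin n => outputState N θ).submatrix (regroup S C n) (regroup S C n) := by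
  ext p q
  change (∑ a : ∀ k, Fin n → A k, ∑ a' : ∀ k, Fin n → A k,
    (∏ k, ∏ t, θ k (p.1 k t, a k t) (q.1 k t, a' k t)) *
      ∏ t, N (Matrix.single (fun k => a k t) (fun k => a' k t) 1) (p.2 t) (q.2 t)) =
    ∏ t, N (Matrix.of fun a a' : ∀ k, A k => ∏ k, θ k (p.1 k t, a k) (q.1 k t, a' k))
      (p.2 t) (q.2 t)
  let f : Fin n → (∀ k, A k) → (∀ k, A k) → ℂ := fun t a a' =>
    (∏ k, θ k (p.1 k t, a k) (q.1 k t, a' k)) * N (Matrix.single a a' 1) (p.2 t) (q.2 t)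
  have e1 : ∀ (a a' : ∀ k, Fin n → A k),
      (∏ k, ∏ t, θ k (p.1 k t, a k t) (q.1 k t, a' k t)) *
      ∏ t, N (Matrix.single (fun k => a k t) (fun k => a' k t) 1) (p.2 t) (q.2 t) =
      ∏ t, f t (fun k => a k t) (fun k => a' k t) := by
    intro a a'
    rw [Finset.prod_comm, ← Finset.prod_mul_distrib]
  simp only [e1]
  have e2 : ∀ g : (Fin n → ∀ k, A k) → ℂ,
      ∑ a : ∀ k, Fin n → A k, g (fun t k => a k t) = ∑ a, g a := fun g =>
    (Equiv.piComm (fun (k : Fin K) (_ : Fin n) => A k)).sum_comp g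
  calc (∑ a : ∀ k, Fin n → A k, ∑ a' : ∀ k, Fin n → A k,
        ∏ t, f t (fun k => a k t) (fun k => a' k t))
      = ∑ a : ∀ k, Fin n → A k, ∑ a' : Fin n → ∀ k, A k,
        ∏ t, f t (fun k => a k t) (a' t) :=
        Finset.sum_congr rfl fun a _ => e2 fun a' => ∏ t, f t (fun k => a k t) (a' t)
    _ = ∑ a : Fin n → ∀ k, A k, ∑ a' : Fin n → ∀ k, A k, ∏ t, f t (a t) (a' t) :=
        e2 fun a => ∑ a' : Fin n → ∀ k, A k, ∏ t, f t (a t) (a' t)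
    _ = ∑ a : Fin n → ∀ k, A k, ∏ t, ∑ a', f t (a t) a' :=
        Finset.sum_congr rfl fun a _ => sum_prod_eq_prod_sum fun t a' => f t (a t) a'
    _ = ∏ t, ∑ a, ∑ a', f t a a' := sum_prod_eq_prod_sum fun t a => ∑ a', f t a a'
    _ = _ := Finset.prod_congr rfl fun t _ => (map_eq_sum_single N _ _ _).symm

lemma marginalCompl_piTensor (J : Finset (Fin K))
    (ω : Matrix ((∀ k, S k) × C) ((∀ k, S k) × C) ℂ) (n : ℕ) :
    marginalCompl J ((piTensor fun _ : Fin n => ω).submatrix (regroup S C n) (regroup S C n)) =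
      (piTensor fun _ : Fin n => marginalCompl J ω).submatrix
        (regroup (fun k : {k // k ∉ J} => S k) C n)
        (regroup (fun k : {k // k ∉ J} => S k) C n) := by
  ext p q
  have hsplit : ∀ (t : ∀ k : {k // k ∈ J}, Fin n → S k) (s : ∀ k : {k // k ∉ J}, Fin n → S k)
      (τ : Fin n), (fun k => (Equiv.piEquivPiSubtypeProd (· ∈ J) fun k => Fin n → S k).symm
        (t, s) k τ) = (Equiv.piEquivPiSubtypeProd (· ∈ J) S).symm
          (fun k => t k τ, fun k => s k τ) := by
    intro t s τ
    ext k
    by_cases hk : k ∈ J <;> simp [hk]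
  change (∑ t : ∀ k : {k // k ∈ J}, Fin n → S k, ∏ τ,
    ω (fun k => (Equiv.piEquivPiSubtypeProd (· ∈ J) fun k => Fin n → S k).symm
        (t, p.1) k τ, p.2 τ)
      (fun k => (Equiv.piEquivPiSubtypeProd (· ∈ J) fun k => Fin n → S k).symm
        (t, q.1) k τ, q.2 τ)) = _
  simp only [hsplit]
  let f : Fin n → (∀ k : {k // k ∈ J}, S k) → ℂ := fun τ t =>
    ω ((Equiv.piEquivPiSubtypeProd (· ∈ J) S).symm (t, fun k => p.1 k τ), p.2 τ)
      ((Equiv.piEquivPiSubtypeProd (· ∈ J) S).symm (t, fun k => q.1 k τ), q.2 τ)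
  exact ((Equiv.piComm (fun (k : {k // k ∈ J}) (_ : Fin n) => S k)).sum_comp
    fun t => ∏ τ, f τ (t τ)).trans (sum_prod_eq_prod_sum f)

/-- The factors in `J` are traced to `1`. Hence the inverse square root in the collision entropy is
diagonal in the same product basis as the projection `Q`. -/
lemma traceRight_marginalCompl (J : Finset (Fin K))
    {ω : Matrix ((∀ k, S k) × C) ((∀ k, S k) × C) ℂ} {σ : ∀ k, Matrix (S k) (S k) ℂ}
    (hσ : ∀ k, (σ k).trace = 1) (hω : traceRight ω = piTensor σ) :
    traceRight (marginalCompl J ω) = piTensor fun k : {k // k ∉ J} => σ k := by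
  ext s s'
  have h1 : traceRight (marginalCompl J ω) s s' =
      ∑ t : ∀ k : {k // k ∈ J}, S k, traceRight ω
        ((Equiv.piEquivPiSubtypeProd (· ∈ J) S).symm (t, s))
        ((Equiv.piEquivPiSubtypeProd (· ∈ J) S).symm (t, s')) := by
    simp only [traceRight, marginalCompl, of_apply]
    exact Finset.sum_comm
  have h2 : ∀ t : ∀ k : {k // k ∈ J}, S k, traceRight ω
        ((Equiv.piEquivPiSubtypeProd (· ∈ J) S).symm (t, s))
        ((Equiv.piEquivPiSubtypeProd (· ∈ J) S).symm (t, s')) =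
      (∏ k : {k // k ∈ J}, σ k (t k) (t k)) * ∏ k : {k // k ∉ J}, σ k (s k) (s' k) := by
    intro t
    rw [hω]
    simp only [piTensor, of_apply]
    rw [← Fintype.prod_subtype_mul_prod_subtype (· ∈ J)]
    congr 1
    · refine Finset.prod_congr (Finset.ext fun _ => by simp) fun k _ => ?_
      simp [k.2]
    · refine Finset.prod_congr (Finset.ext fun _ => by simp) fun k _ => ?_
      simp [k.2]
  rw [h1, Finset.sum_congr rfl fun t _ => h2 t, ← Finset.sum_mul,
    sum_prod_eq_prod_sum fun (k : {k // k ∈ J}) x => σ k x x,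
    show (∏ k : {k // k ∈ J}, ∑ x, σ k x x) = 1 from Finset.prod_eq_one fun k _ => hσ k, one_mul]
  rfl

end ManyUses

/-! ### The second kind of error -/

section CrossTerm

set_option linter.unusedSectionVars false

variable {K : ℕ} {S : Fin K → Type*} {D : Type*}
  [∀ k, Fintype (S k)] [∀ k, DecidableEq (S k)] [Fintype D] [DecidableEq D]

/-- Separation of the systems in `J` from the others. -/
def splitOff (S : Fin K → Type*) (D : Type*) (J : Finset (Fin K)) :
    (∀ k, S k) × D ≃ (∀ k : {k // k ∈ J}, S k) × ((∀ k : {k // k ∉ J}, S k) × D) :=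
  ((Equiv.piEquivPiSubtypeProd (· ∈ J) S).prodCongr (Equiv.refl D)).trans
    (Equiv.prodAssoc _ _ _)

lemma crossState_eq_submatrix (J : Finset (Fin K)) (θ : ∀ k, Matrix (S k) (S k) ℂ)
    (ω : Matrix ((∀ k, S k) × D) ((∀ k, S k) × D) ℂ) :
    crossState J θ ω = ((piTensor fun k : {k // k ∈ J} => θ k) ⊗ₖ marginalCompl J ω).submatrix
      (splitOff S D J) (splitOff S D J) := rfl

lemma piTensor_kronecker_one (J : Finset (Fin K)) (Q : ∀ k, Matrix (S k) (S k) ℂ) :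
    piTensor Q ⊗ₖ (1 : Matrix D D ℂ) =
      ((piTensor fun k : {k // k ∈ J} => Q k) ⊗ₖ
        ((piTensor fun k : {k // k ∉ J} => Q k) ⊗ₖ (1 : Matrix D D ℂ))).submatrix
      (splitOff S D J) (splitOff S D J) := by
  ext p q
  simp only [kroneckerMap_apply, piTensor, of_apply, submatrix_apply]
  rw [← mul_assoc, ← Fintype.prod_subtype_mul_prod_subtype (· ∈ J)]
  congr 1
  congr 1
  · exact Finset.prod_congr (Finset.ext fun _ => by simp) fun k _ => rfl

/-- Partial trace is adjoint to tensoring with the identity. -/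
lemma trace_mul_one_kronecker (J : Finset (Fin K))
    (ω : Matrix ((∀ k, S k) × D) ((∀ k, S k) × D) ℂ)
    (Z : Matrix ((∀ k : {k // k ∉ J}, S k) × D) ((∀ k : {k // k ∉ J}, S k) × D) ℂ) :
    (ω * ((1 : Matrix (∀ k : {k // k ∈ J}, S k) (∀ k : {k // k ∈ J}, S k) ℂ) ⊗ₖ Z).submatrix
      (splitOff S D J) (splitOff S D J)).trace = (marginalCompl J ω * Z).trace := by
  have h : ω = (ω.submatrix (splitOff S D J).symm (splitOff S D J).symm).submatrix
      (splitOff S D J) (splitOff S D J) := by simp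
  conv_lhs => rw [h, submatrix_mul_equiv]
  simp only [Matrix.trace, diag_apply, submatrix_apply]
  rw [(splitOff S D J).sum_comp fun i => (ω.submatrix (splitOff S D J).symm
    (splitOff S D J).symm * ((1 : Matrix (∀ k : {k // k ∈ J}, S k)
      (∀ k : {k // k ∈ J}, S k) ℂ) ⊗ₖ Z)) i i]
  simp only [mul_apply, Fintype.sum_prod_type (α₁ := ∀ k : {k // k ∈ J}, S k),
    kroneckerMap_apply, one_apply, ite_mul, one_mul, zero_mul, mul_ite, mul_zero]
  rw [Finset.sum_comm]
  refine Finset.sum_congr rfl fun y _ => ?_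
  simp only [marginalCompl, of_apply, Finset.sum_mul]
  refine (Finset.sum_congr rfl fun x _ => ?_).trans Finset.sum_comm
  rw [Finset.sum_comm]
  refine Finset.sum_congr rfl fun z _ => ?_
  rw [Finset.sum_ite_eq' Finset.univ x, if_pos (Finset.mem_univ x)]
  rfl

lemma marginalCompl_posSemidef (J : Finset (Fin K))
    {ω : Matrix ((∀ k, S k) × D) ((∀ k, S k) × D) ℂ} (hω : ω.PosSemidef) :
    (marginalCompl J ω).PosSemidef := by
  have : marginalCompl J ω = ∑ t, ω.submatrix (fun p => (splitOff S D J).symm (t, p))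
      (fun p => (splitOff S D J).symm (t, p)) := by
    ext p q
    rw [Matrix.sum_apply]
    rfl
  rw [this]
  exact posSemidef_sum _ fun t _ => hω.submatrix _

lemma crossState_posSemidef (J : Finset (Fin K)) {θ : ∀ k, Matrix (S k) (S k) ℂ}
    (hθ : ∀ k, (θ k).PosSemidef) {ω : Matrix ((∀ k, S k) × D) ((∀ k, S k) × D) ℂ}
    (hω : ω.PosSemidef) : (crossState J θ ω).PosSemidef := by
  rw [crossState_eq_submatrix]
  exact ((piTensor_posSemidef fun k : {k // k ∈ J} => hθ k).kronecker
    (marginalCompl_posSemidef J hω)).submatrix _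

/-- The two occurrences of `Q` are replaced one at a time: the cofactors `m Q m` and `m R m` are
positive, and cyclicity brings the other occurrence to the end. -/
lemma re_trace_sandwich_le {X : Type*} [Fintype X] [DecidableEq X] {m Q R : Matrix X X ℂ}
    (hm : m.PosSemidef) (hQ : Q.PosSemidef) (hR : R.PosSemidef) {s : ℝ} (hs : 0 ≤ s)
    (h : Q ≤ (s : ℂ) • R) :
    (m * Q * m * Q).trace.re ≤ s * s * (m * R * m * R).trace.re := by
  have hsand : ∀ {Z : Matrix X X ℂ}, Z.PosSemidef → (m * Z * m).PosSemidef := fun hZ => by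
    have := hZ.mul_mul_conjTranspose_same m
    rwa [hm.1.eq] at this
  have hsmul : ∀ Y Z : Matrix X X ℂ, (Y * ((s : ℂ) • Z)).trace.re = s * (Y * Z).trace.re := by
    intro Y Z
    rw [Matrix.mul_smul, Matrix.trace_smul, smul_eq_mul, Complex.re_ofReal_mul]
  have e : (m * Q * m * R).trace = (m * R * m * Q).trace := by
    rw [Matrix.mul_assoc (m * Q), Matrix.trace_mul_comm (m * Q), ← Matrix.mul_assoc]
  calc (m * Q * m * Q).trace.re ≤ (m * Q * m * ((s : ℂ) • R)).trace.re :=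
        re_trace_mul_le_right h (hsand hQ)
    _ = s * (m * R * m * Q).trace.re := by rw [hsmul, e]
    _ ≤ s * (m * R * m * ((s : ℂ) • R)).trace.re :=
        mul_le_mul_of_nonneg_left (re_trace_mul_le_right h (hsand hR)) hs
    _ = s * s * (m * R * m * R).trace.re := by rw [hsmul]; ring

/-- The overlap of the test `Q P Q` with a cross state, where `P ≤ a ω` and where `Q` projects onto
eigenvectors of the `θ_k` with positive eigenvalues at most `b_k`. -/
lemma re_trace_mul_crossState_le (J : Finset (Fin K))
    {ω P : Matrix ((∀ k, S k) × D) ((∀ k, S k) × D) ℂ} (hω : ω.PosSemidef)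
    {W : ∀ k, Matrix (S k) (S k) ℂ} (hW : ∀ k, (W k)ᴴ * W k = 1) {p q : ∀ k, S k → ℝ}
    {b : Fin K → ℝ} (hb : ∀ k, 0 ≤ b k) (hp : ∀ k x, 0 ≤ p k x)
    (hq : ∀ k x, q k x = 0 ∨ q k x = 1 ∧ 0 < p k x ∧ p k x ≤ b k)
    {a : ℝ} (ha : 0 ≤ a) (hP : P ≤ (a : ℂ) • ω) :
    ((piTensor fun k => ofEigen (W k) (q k)) ⊗ₖ (1 : Matrix D D ℂ) * P *
        ((piTensor fun k => ofEigen (W k) (q k)) ⊗ₖ (1 : Matrix D D ℂ)) *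
      crossState J (fun k => ofEigen (W k) (p k)) ω).trace.re ≤
    a * (∏ k, b k) * (marginalCompl J ω *
      ((piTensor fun k : {k // k ∉ J} => ofEigen (W k) fun x => (√(p k x))⁻¹) ⊗ₖ
        (1 : Matrix D D ℂ)) * marginalCompl J ω *
      ((piTensor fun k : {k // k ∉ J} => ofEigen (W k) fun x => (√(p k x))⁻¹) ⊗ₖ
        (1 : Matrix D D ℂ))).trace.re := by
  have hq0 : ∀ k x, 0 ≤ q k x := fun k x => by
    rcases hq k x with h | ⟨h, -⟩ <;> simp [h]
  set Q := (piTensor fun k => ofEigen (W k) (q k)) ⊗ₖ (1 : Matrix D D ℂ) with hQdef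
  set m := marginalCompl J ω with hmdef
  set QJ := piTensor fun k : {k // k ∈ J} => ofEigen (W k) (q k) with hQJ
  set θJ := piTensor fun k : {k // k ∈ J} => ofEigen (W k) (p k) with hθJ
  set Qc := (piTensor fun k : {k // k ∉ J} => ofEigen (W k) (q k)) ⊗ₖ (1 : Matrix D D ℂ) with hQc
  set R := (piTensor fun k : {k // k ∉ J} => ofEigen (W k) fun x => (√(p k x))⁻¹) ⊗ₖ
    (1 : Matrix D D ℂ) with hR
  set X := crossState J (fun k => ofEigen (W k) (p k)) ω with hX
  have hm : m.PosSemidef := marginalCompl_posSemidef J hω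
  have hXps : X.PosSemidef :=
    crossState_posSemidef J (fun k => ofEigen_posSemidef _ (hp k)) hω
  have hQps : Q.PosSemidef :=
    (piTensor_posSemidef fun k => ofEigen_posSemidef _ (hq0 k)).kronecker PosSemidef.one
  have hQcps : Qc.PosSemidef :=
    (piTensor_posSemidef fun k : {k // k ∉ J} => ofEigen_posSemidef _ (hq0 k)).kronecker
      PosSemidef.one
  have hRps : R.PosSemidef :=
    (piTensor_posSemidef fun k : {k // k ∉ J} => ofEigen_posSemidef _
      fun x => inv_nonneg.mpr (Real.sqrt_nonneg _)).kronecker PosSemidef.one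
  have hQXQ : (Q * X * Q).PosSemidef := by
    have := hXps.mul_mul_conjTranspose_same Q
    rwa [hQps.1.eq] at this
  have hQmQ : (Qc * m * Qc).PosSemidef := by
    have := hm.mul_mul_conjTranspose_same Qc
    rwa [hQcps.1.eq] at this
  -- Both `Q` and the cross state are products across the cut between `S(J)` and `S(Jᶜ) D`.
  have hsplit : Q * X * Q = ((QJ * θJ * QJ) ⊗ₖ (Qc * m * Qc)).submatrix
      (splitOff S D J) (splitOff S D J) := by
    rw [hQdef, piTensor_kronecker_one J, hX, crossState_eq_submatrix, submatrix_mul_equiv,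
      submatrix_mul_equiv, ← mul_kronecker_mul, ← mul_kronecker_mul]
  set bJ : ℝ := ∏ k : {k // k ∈ J}, b k with hbJ
  have hJle : QJ * θJ * QJ ≤ (bJ : ℂ) • 1 := by
    rw [hQJ, hθJ, piTensor_mul, piTensor_mul]
    simp only [ofEigen_mul (hW _)]
    rw [piTensor_ofEigen, ← ofEigen_one (piTensor_unitary fun k : {k // k ∈ J} => hW k),
      ofEigen_smul]
    refine ofEigen_mono _ fun x => ?_
    rw [mul_one]
    refine Finset.prod_le_prod (fun k _ => ?_) fun k _ => ?_
    · exact mul_nonneg (mul_nonneg (hq0 _ _) (hp _ _)) (hq0 _ _)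
    · rcases hq k (x k) with h | ⟨h, -, h'⟩
      · simp [h, hb]
      · simpa [h] using h'
  have hQXQle : Q * X * Q ≤ (bJ : ℂ) • ((1 : Matrix (∀ k : {k // k ∈ J}, S k)
      (∀ k : {k // k ∈ J}, S k) ℂ) ⊗ₖ (Qc * m * Qc)).submatrix
        (splitOff S D J) (splitOff S D J) := by
    have h1 := ((Matrix.le_iff.mp hJle).kronecker hQmQ).submatrix (splitOff S D J)
    rw [Matrix.le_iff, hsplit]
    convert h1 using 1
    ext x y
    simp [sub_mul, mul_assoc]
  set s : ℝ := ∏ k : {k // k ∉ J}, √(b k) with hs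
  have hs0 : 0 ≤ s := Finset.prod_nonneg fun k _ => Real.sqrt_nonneg _
  -- Where `q = 1` one has `0 < p ≤ b`, so `1 ≤ √b (√p)⁻¹`. Positivity of `p` is essential, since
  -- `(√0)⁻¹ = 0` here.
  have hQcle : Qc ≤ (s : ℂ) • R := by
    have h1 : (piTensor fun k : {k // k ∉ J} => ofEigen (W k) (q k)) ≤
        (s : ℂ) • piTensor fun k : {k // k ∉ J} => ofEigen (W k) fun x => (√(p k x))⁻¹ := by
      rw [piTensor_ofEigen, piTensor_ofEigen, ofEigen_smul]
      refine ofEigen_mono _ fun x => ?_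
      rw [hs, ← Finset.prod_mul_distrib]
      refine Finset.prod_le_prod (fun k _ => hq0 _ _) fun k _ => ?_
      rcases hq k (x k) with h | ⟨h, h0, h'⟩
      · rw [h]; positivity
      · rw [h, ← div_eq_mul_inv, one_le_div (Real.sqrt_pos.mpr h0)]
        exact Real.sqrt_le_sqrt h'
    have h2 := (Matrix.le_iff.mp h1).kronecker (PosSemidef.one (n := D) (R := ℂ))
    rw [Matrix.le_iff]
    convert h2 using 1
    ext x y
    simp [hR, hQc, sub_mul, mul_assoc]
  have hbs : bJ * (s * s) = ∏ k, b k := by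
    have h1 : s * s = ∏ k : {k // k ∉ J}, b k := by
      rw [hs, ← Finset.prod_mul_distrib]
      exact Finset.prod_congr rfl fun k _ => Real.mul_self_sqrt (hb k)
    rw [h1, hbJ, ← Fintype.prod_subtype_mul_prod_subtype (· ∈ J) b]
    congr 1
    exact Finset.prod_congr (Finset.ext fun _ => by simp) fun k _ => rfl
  have hcyc : (Q * P * Q * X).trace = (P * (Q * X * Q)).trace := by
    rw [Matrix.mul_assoc (Q * P), Matrix.mul_assoc Q, Matrix.trace_mul_comm Q]
    simp only [Matrix.mul_assoc]
  calc (Q * P * Q * X).trace.re = (P * (Q * X * Q)).trace.re := by rw [hcyc]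
    _ ≤ ((a : ℂ) • ω * (Q * X * Q)).trace.re := re_trace_mul_le_left hP hQXQ
    _ = a * (ω * (Q * X * Q)).trace.re := by
        rw [Matrix.smul_mul, Matrix.trace_smul, smul_eq_mul, Complex.re_ofReal_mul]
    _ ≤ a * (bJ * (m * Qc * m * Qc).trace.re) := by
        refine mul_le_mul_of_nonneg_left ((re_trace_mul_le_right hQXQle hω).trans (le_of_eq ?_)) ha
        rw [Matrix.mul_smul, Matrix.trace_smul, smul_eq_mul, Complex.re_ofReal_mul,
          trace_mul_one_kronecker]
        simp only [hmdef, Matrix.mul_assoc]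
    _ ≤ a * (bJ * (s * s * (m * R * m * R).trace.re)) := by
        refine mul_le_mul_of_nonneg_left (mul_le_mul_of_nonneg_left
          (re_trace_sandwich_le hm hQcps hRps hs0 hQcle) ?_) ha
        exact Finset.prod_nonneg fun k _ => hb k
    _ = a * (∏ k, b k) * (m * R * m * R).trace.re := by rw [← hbs]; ring

end CrossTerm

open Filter Topology

/-! ### Entropies and typical sequences -/

section Typicality

variable {X : Type*} [Fintype X]

/-- The Shannon entropy in nats. -/
def shannon (d : X → ℝ) : ℝ := ∑ x, Real.negMulLog (d x)

lemma entropy_ofEigen [DecidableEq X] {U : Matrix X X ℂ} (hU : Uᴴ * U = 1) (d : X → ℝ) :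
    entropy (ofEigen U d) = shannon d / Real.log 2 := by
  rw [entropy, cfc_ofEigen hU, trace_ofEigen hU, shannon, ← Complex.ofReal_sum, Complex.ofReal_re]

/-- The logarithm splits the summand into terms that are again products over the factors, with one
factor replaced by its `negMulLog`; the other factors sum to `1`. -/
lemma shannon_prod {ι : Type*} [Fintype ι] [DecidableEq ι] {X : ι → Type*} [∀ k, Fintype (X k)]
    {d : ∀ k, X k → ℝ} (hd : ∀ k, ∑ x, d k x = 1) :
    shannon (fun x : ∀ k, X k => ∏ k, d k (x k)) = ∑ k, shannon (d k) := by
  have h1 : ∀ x : ∀ k, X k, Real.negMulLog (∏ k, d k (x k)) =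
      ∑ k, ∏ j, if j = k then Real.negMulLog (d j (x j)) else d j (x j) := by
    intro x
    have h2 : ∀ k, (∏ j, if j = k then Real.negMulLog (d j (x j)) else d j (x j)) =
        (∏ j, d j (x j)) * -Real.log (d k (x k)) := by
      intro k
      rw [Fintype.prod_eq_mul_prod_compl k, Fintype.prod_eq_mul_prod_compl k, if_pos rfl,
        Real.negMulLog, Finset.prod_congr rfl fun j hj => if_neg (by simpa using hj)]
      ring
    simp only [h2, ← Finset.mul_sum, Finset.sum_neg_distrib]
    by_cases h0 : ∃ k, d k (x k) = 0
    · obtain ⟨k, hk⟩ := h0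
      rw [Finset.prod_eq_zero (Finset.mem_univ k) hk]
      simp
    · push Not at h0
      rw [Real.negMulLog, Real.log_prod fun k _ => h0 k]
      ring
  simp only [shannon, h1]
  rw [Finset.sum_comm]
  refine Finset.sum_congr rfl fun k _ => ?_
  rw [sum_prod_eq_prod_sum fun j y => if j = k then Real.negMulLog (d j y) else d j y,
    Finset.prod_eq_single k]
  · simp
  · intro j _ hj
    simp [hj, hd]
  · simp

/-- The moment generating function is `1` at `0` and its derivative there is the negative mean. -/
lemma exists_sum_mul_exp_lt_one {d f : X → ℝ} (hd1 : ∑ x, d x = 1)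
    (hf : ∑ x, d x * f x < 0) : ∃ s > 0, ∑ x, d x * Real.exp (s * f x) < 1 := by
  have hderiv : HasDerivAt (fun s : ℝ => ∑ x, d x * Real.exp (s * f x)) (∑ x, d x * f x) 0 := by
    refine HasDerivAt.fun_sum fun x _ => ?_
    have h1 : HasDerivAt (fun s : ℝ => s * f x) (f x) 0 := by
      simpa using (hasDerivAt_id (0 : ℝ)).mul_const (f x)
    have := (h1.exp).const_mul (d x)
    simpa using this
  have hslope := (hasDerivAt_iff_tendsto_slope.mp hderiv).eventually (gt_mem_nhds hf)
  have hslope' := hslope.filter_mono (nhdsWithin_mono (0 : ℝ) (s := Set.Ioi 0) (t := {0}ᶜ)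
    fun s hs => ne_of_gt hs)
  obtain ⟨s, hs, hs0⟩ := (hslope'.and self_mem_nhdsWithin).exists
  refine ⟨s, hs0, ?_⟩
  rw [slope_def_field, sub_zero] at hs
  have h2 := (div_neg_iff.mp hs).resolve_left fun h => not_lt.mpr hs0.le h.2
  simp only [zero_mul, Real.exp_zero, mul_one, hd1] at h2
  linarith [h2.1]

/-- Chernoff bound: off the event `q = 1` the sum of the `f (x t)` is nonnegative, so the missing
mass is at most the `n`-th power of a moment generating value below `1`. Sequences of probability
zero contribute nothing. -/
lemma tendsto_sum_typical {d f : X → ℝ} (hd : ∀ x, 0 ≤ d x) (hd1 : ∑ x, d x = 1)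
    (hf : ∑ x, d x * f x < 0) {q : ∀ n, (Fin n → X) → ℝ} (hq0 : ∀ n x, 0 ≤ q n x)
    (hq1 : ∀ n x, q n x ≤ 1)
    (hq : ∀ n x, (∀ t, 0 < d (x t)) → q n x = 1 ∨ 0 ≤ ∑ t, f (x t)) :
    Tendsto (fun n : ℕ => ∑ x : Fin n → X, q n x * ∏ t, d (x t)) atTop (𝓝 1) := by
  obtain ⟨s, hs, hlt⟩ := exists_sum_mul_exp_lt_one hd1 hf
  set r := ∑ x, d x * Real.exp (s * f x) with hr
  have hr0 : 0 ≤ r := Finset.sum_nonneg fun x _ => mul_nonneg (hd x) (Real.exp_pos _).le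
  have htot : ∀ n : ℕ, ∑ x : Fin n → X, ∏ t, d (x t) = 1 := fun n => by
    rw [sum_prod_eq_prod_sum fun (_ : Fin n) x => d x]
    simp [hd1]
  have hprod : ∀ n (x : Fin n → X), 0 ≤ ∏ t, d (x t) := fun n x =>
    Finset.prod_nonneg fun t _ => hd _
  have hlow : ∀ n : ℕ, 1 - r ^ n ≤ ∑ x : Fin n → X, q n x * ∏ t, d (x t) := by
    intro n
    have h1 : r ^ n = ∑ x : Fin n → X, ∏ t, (d (x t) * Real.exp (s * f (x t))) := by
      rw [sum_prod_eq_prod_sum fun (_ : Fin n) x => d x * Real.exp (s * f x)]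
      simp [hr]
    rw [h1, ← htot n, ← Finset.sum_sub_distrib]
    refine Finset.sum_le_sum fun x _ => ?_
    rw [Finset.prod_mul_distrib, ← Real.exp_sum, ← Finset.mul_sum]
    by_cases hpos : ∀ t, 0 < d (x t)
    · rcases hq n x hpos with h | h
      · rw [h, one_mul]
        have := mul_nonneg (hprod n x) (Real.exp_pos (s * ∑ t, f (x t))).le
        linarith
      · have h2 : 1 ≤ Real.exp (s * ∑ t, f (x t)) := Real.one_le_exp (mul_nonneg hs.le h)
        have h3 := mul_le_mul_of_nonneg_left h2 (hprod n x)
        have h4 := mul_nonneg (hq0 n x) (hprod n x)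
        linarith
    · push Not at hpos
      obtain ⟨t, ht⟩ := hpos
      rw [Finset.prod_eq_zero (Finset.mem_univ t) (le_antisymm ht (hd _))]
      simp
  have hup : ∀ n : ℕ, ∑ x : Fin n → X, q n x * ∏ t, d (x t) ≤ 1 := by
    intro n
    rw [← htot n]
    exact Finset.sum_le_sum fun x _ => mul_le_of_le_one_left (hprod n x) (hq1 n x)
  refine tendsto_of_tendsto_of_tendsto_of_le_of_le ?_ tendsto_const_nhds hlow hup
  simpa using (tendsto_pow_atTop_nhds_zero_of_lt_one hr0 hlt).const_sub 1

/-- The indicator of the sequences of positive probability at most `e ^ (-n (H - δ))`. -/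
def lowProb (d : X → ℝ) (δ : ℝ) (n : ℕ) (x : Fin n → X) : ℝ :=
  open scoped Classical in
  if 0 < ∏ t, d (x t) ∧ ∏ t, d (x t) ≤ Real.exp (-(n * (shannon d - δ))) then 1 else 0

/-- The indicator of the sequences of probability at least `e ^ (-n (H + δ))`. -/
def highProb (d : X → ℝ) (δ : ℝ) (n : ℕ) (x : Fin n → X) : ℝ :=
  open scoped Classical in
  if Real.exp (-(n * (shannon d + δ))) ≤ ∏ t, d (x t) then 1 else 0

lemma sum_mul_log (d : X → ℝ) : ∑ x, d x * Real.log (d x) = -shannon d := by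
  simp [shannon, Real.negMulLog]

lemma tendsto_sum_lowProb {d : X → ℝ} (hd : ∀ x, 0 ≤ d x) (hd1 : ∑ x, d x = 1) {δ : ℝ}
    (hδ : 0 < δ) :
    Tendsto (fun n : ℕ => ∑ x : Fin n → X, lowProb d δ n x * ∏ t, d (x t)) atTop (𝓝 1) := by
  classical
  refine tendsto_sum_typical (f := fun x => Real.log (d x) + (shannon d - δ)) hd hd1 ?_
    (fun n x => ?_) (fun n x => ?_) fun n x hx => ?_
  · simp only [mul_add, Finset.sum_add_distrib, ← Finset.sum_mul, hd1, sum_mul_log]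
    linarith
  · rw [lowProb]; split_ifs <;> norm_num
  · rw [lowProb]; split_ifs <;> norm_num
  · have hpos : 0 < ∏ t, d (x t) := Finset.prod_pos fun t _ => hx t
    by_cases h : ∏ t, d (x t) ≤ Real.exp (-(n * (shannon d - δ)))
    · exact Or.inl (if_pos ⟨hpos, h⟩)
    · right
      rw [not_le, ← Real.lt_log_iff_exp_lt hpos, Real.log_prod fun t _ => (hx t).ne'] at h
      rw [Finset.sum_add_distrib]
      simp only [Finset.sum_const, Finset.card_univ, Fintype.card_fin, nsmul_eq_mul]
      linarith

lemma tendsto_sum_highProb {d : X → ℝ} (hd : ∀ x, 0 ≤ d x) (hd1 : ∑ x, d x = 1) {δ : ℝ}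
    (hδ : 0 < δ) :
    Tendsto (fun n : ℕ => ∑ x : Fin n → X, highProb d δ n x * ∏ t, d (x t)) atTop (𝓝 1) := by
  classical
  refine tendsto_sum_typical (f := fun x => -Real.log (d x) - (shannon d + δ)) hd hd1 ?_
    (fun n x => ?_) (fun n x => ?_) fun n x hx => ?_
  · simp only [mul_sub, mul_neg, Finset.sum_sub_distrib, Finset.sum_neg_distrib,
      ← Finset.sum_mul, hd1, sum_mul_log]
    linarith
  · rw [highProb]; split_ifs <;> norm_num
  · rw [highProb]; split_ifs <;> norm_num
  · have hpos : 0 < ∏ t, d (x t) := Finset.prod_pos fun t _ => hx t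
    by_cases h : Real.exp (-(n * (shannon d + δ))) ≤ ∏ t, d (x t)
    · exact Or.inl (if_pos h)
    · right
      rw [not_le, ← Real.log_lt_iff_lt_exp hpos, Real.log_prod fun t _ => (hx t).ne'] at h
      rw [Finset.sum_sub_distrib, Finset.sum_neg_distrib]
      simp only [Finset.sum_const, Finset.card_univ, Fintype.card_fin, nsmul_eq_mul]
      linarith

end Typicality

/-! ### Tests -/

section Tests

set_option linter.unusedSectionVars false

lemma sandwich_posSemidef {X : Type*} [Fintype X] {Q P : Matrix X X ℂ} (hQ : Q.IsHermitian)
    (hP : P.PosSemidef) : (Q * P * Q).PosSemidef := by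
  have := hP.mul_mul_conjTranspose_same Q
  rwa [hQ.eq] at this

lemma one_sub_sandwich {X : Type*} [Fintype X] [DecidableEq X] {Q : Matrix X X ℂ}
    (hQQ : Q * Q = Q) (P : Matrix X X ℂ) :
    1 - Q * P * Q = (1 - Q) + Q * (1 - P) * Q := by
  rw [Matrix.mul_sub, Matrix.mul_one, Matrix.sub_mul, hQQ]
  abel

lemma one_sub_posSemidef {X : Type*} [Fintype X] [DecidableEq X] {Q : Matrix X X ℂ}
    (hQ : Q.IsHermitian) (hQQ : Q * Q = Q) : (1 - Q).PosSemidef := by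
  have : 1 - Q = (1 - Q)ᴴ * (1 - Q) := by
    rw [conjTranspose_sub, conjTranspose_one, hQ.eq, Matrix.mul_sub, Matrix.sub_mul _ _ Q, hQQ]
    simp
  rw [this]
  exact posSemidef_conjTranspose_mul_self _

lemma one_sub_sandwich_posSemidef {X : Type*} [Fintype X] [DecidableEq X] {Q P : Matrix X X ℂ}
    (hQ : Q.IsHermitian) (hQQ : Q * Q = Q) (hP1 : (1 - P).PosSemidef) :
    (1 - Q * P * Q).PosSemidef := by
  rw [one_sub_sandwich hQQ]
  exact (one_sub_posSemidef hQ hQQ).add (sandwich_posSemidef hQ hP1)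

/-- A noncommutative union bound: the right side minus the left is the trace of a positive operator
against `ω`. Neither commutation of `P` and `Q` nor idempotence of `P` is needed. -/
lemma re_trace_one_sub_sandwich_le {X : Type*} [Fintype X] [DecidableEq X]
    {Q P ω : Matrix X X ℂ} (hQ : Q.IsHermitian) (hQQ : Q * Q = Q) (hP : P.PosSemidef)
    (hP1 : (1 - P).PosSemidef) (hω : ω.PosSemidef) :
    ((1 - Q * P * Q) * ω).trace.re ≤
      3 * ((1 - Q) * ω).trace.re + 2 * ((1 - P) * ω).trace.re := by
  have h1 : ((2 - Q) * (1 - P) * (2 - Q)).PosSemidef :=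
    sandwich_posSemidef (by
      rw [IsHermitian, conjTranspose_sub, hQ.eq]
      congr 1
      exact conjTranspose_ofNat 2) hP1
  have h2 : ((1 - Q) * P * (1 - Q)).PosSemidef :=
    sandwich_posSemidef (isHermitian_one.sub hQ) hP
  have h := add_nonneg (re_trace_mul_nonneg h1 hω)
    (mul_nonneg zero_le_two (re_trace_mul_nonneg h2 hω))
  have e : (2 - Q) * (1 - P) * (2 - Q) + (2 : ℂ) • ((1 - Q) * P * (1 - Q)) =
      (3 : ℂ) • (1 - Q) + (2 : ℂ) • (1 - P) - (1 - Q * P * Q) := by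
    have e2 : (2 : Matrix X X ℂ) = (2 : ℂ) • 1 := by
      ext i j; simp [ofNat_apply, one_apply]
    rw [e2]
    simp only [Matrix.mul_sub, Matrix.sub_mul, Matrix.mul_one, Matrix.one_mul, Matrix.smul_mul,
      Matrix.mul_smul, hQQ, smul_sub]
    module
  have e' := congrArg (fun Z => (Z * ω).trace.re) e
  simp only [Matrix.add_mul, Matrix.sub_mul _ _ ω, Matrix.smul_mul, Matrix.trace_add,
    Matrix.trace_sub, Matrix.trace_smul, Complex.add_re, Complex.sub_re, smul_eq_mul,
    Complex.mul_re, Complex.re_ofNat, Complex.im_ofNat, zero_mul, sub_zero] at e' h ⊢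
  linarith

lemma trace_kronecker_one_mul {X Y : Type*} [Fintype X] [Fintype Y] [DecidableEq Y]
    (Z : Matrix X X ℂ) (ω : Matrix (X × Y) (X × Y) ℂ) :
    ((Z ⊗ₖ (1 : Matrix Y Y ℂ)) * ω).trace = (Z * traceRight ω).trace := by
  simp only [Matrix.trace, diag_apply, mul_apply, Fintype.sum_prod_type, kroneckerMap_apply,
    one_apply, mul_ite, mul_one, mul_zero, ite_mul, zero_mul, Finset.sum_ite_eq,
    Finset.mem_univ, if_true, traceRight, of_apply, Finset.mul_sum]
  exact Finset.sum_congr rfl fun x _ => Finset.sum_comm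

lemma piTensor_kronecker_one_regroup {κ : Type*} [Fintype κ] [DecidableEq κ] {S : κ → Type*}
    {C : Type*} [DecidableEq C] (n : ℕ) (R : ∀ k, Matrix (S k) (S k) ℂ) :
    (piTensor fun k => piTensor fun _ : Fin n => R k) ⊗ₖ (1 : Matrix (Fin n → C) (Fin n → C) ℂ) =
      (piTensor fun _ : Fin n => piTensor R ⊗ₖ (1 : Matrix C C ℂ)).submatrix
        (regroup S C n) (regroup S C n) := by
  ext p q
  simp only [kroneckerMap_apply, piTensor, of_apply, submatrix_apply, one_apply]
  rw [Finset.prod_comm, Finset.prod_mul_distrib, ← prod_ite_eq_one]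
  rfl

/-- Taking adjoints reverses the product, and cyclicity restores it. Realness lets the real part
commute with the `n`-th power. -/
lemma trace_collision_conj {X : Type*} [Fintype X] {m R : Matrix X X ℂ} (hm : m.IsHermitian)
    (hR : R.IsHermitian) :
    ((m * R * m * R).trace.re : ℂ) = (m * R * m * R).trace := by
  rw [← Complex.conj_eq_iff_re]
  change star _ = _
  rw [← trace_conjTranspose]
  simp only [conjTranspose_mul, hm.eq, hR.eq]
  rw [Matrix.trace_mul_comm]
  simp only [Matrix.mul_assoc]

end Tests

/-! ### Multiplicativity of the collision trace -/

section Collision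

set_option linter.unusedSectionVars false

variable {K : ℕ} {S : Fin K → Type*} {C : Type*}
  [∀ k, Fintype (S k)] [∀ k, DecidableEq (S k)] [Fintype C] [DecidableEq C]

/-- The collision quantity of `n` copies is the `n`-th power of that of one copy. -/
lemma trace_collision_pow (J : Finset (Fin K))
    {ω : Matrix ((∀ k, S k) × C) ((∀ k, S k) × C) ℂ} (hω : ω.PosSemidef)
    {U : ∀ k, Matrix (S k) (S k) ℂ} (hU : ∀ k, (U k)ᴴ * U k = 1) {d : ∀ k, S k → ℝ}
    (hd : ∀ k x, 0 ≤ d k x)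
    (hm : traceRight (marginalCompl J ω) = piTensor fun k : {k // k ∉ J} => ofEigen (U k) (d k))
    (n : ℕ) :
    (marginalCompl J ((piTensor fun _ : Fin n => ω).submatrix (regroup S C n) (regroup S C n)) *
      ((piTensor fun k : {k // k ∉ J} => ofEigen (piTensor fun _ : Fin n => U k)
        fun x => (√(∏ t, d k (x t)))⁻¹) ⊗ₖ (1 : Matrix (Fin n → C) (Fin n → C) ℂ)) *
      marginalCompl J ((piTensor fun _ : Fin n => ω).submatrix (regroup S C n) (regroup S C n)) *
      ((piTensor fun k : {k // k ∉ J} => ofEigen (piTensor fun _ : Fin n => U k)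
        fun x => (√(∏ t, d k (x t)))⁻¹) ⊗ₖ (1 : Matrix (Fin n → C) (Fin n → C) ℂ))).trace.re ≤
    Real.exp (-(n * (Real.log 2 * collisionCondEntropy (marginalCompl J ω)))) := by
  have h1 : ∀ k, (ofEigen (piTensor fun _ : Fin n => U k)
      fun x => (√(∏ t, d k (x t)))⁻¹) =
      piTensor fun _ : Fin n => ofEigen (U k) fun x => (√(d k x))⁻¹ := by
    intro k
    rw [piTensor_ofEigen]
    congr 1
    ext x
    rw [Real.sqrt_prod _ fun t _ => hd k _, Finset.prod_inv_distrib]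
  have h2 : invSqrt (traceRight (marginalCompl J ω)) =
      piTensor fun k : {k // k ∉ J} => ofEigen (U k) fun x => (√(d k x))⁻¹ := by
    rw [hm, piTensor_ofEigen, piTensor_ofEigen, invSqrt,
      cfc_ofEigen (piTensor_unitary fun k : {k // k ∉ J} => hU k)]
    congr 1
    ext x
    rw [Real.sqrt_prod _ fun k _ => hd _ _, Finset.prod_inv_distrib]
  set R := invSqrt (traceRight (marginalCompl J ω)) ⊗ₖ (1 : Matrix C C ℂ) with hR
  set m := marginalCompl J ω with hmdef
  have hmps : m.PosSemidef := marginalCompl_posSemidef J hω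
  have hRps : R.PosSemidef :=
    (invSqrt_posSemidef (traceRight_posSemidef hmps)).kronecker PosSemidef.one
  have hreg : (piTensor fun k : {k // k ∉ J} => ofEigen (piTensor fun _ : Fin n => U k)
        fun x => (√(∏ t, d k (x t)))⁻¹) ⊗ₖ (1 : Matrix (Fin n → C) (Fin n → C) ℂ) =
      (piTensor fun _ : Fin n => R).submatrix (regroup (fun k : {k // k ∉ J} => S k) C n)
        (regroup (fun k : {k // k ∉ J} => S k) C n) := by
    simp only [h1]
    rw [piTensor_kronecker_one_regroup, hR, h2]
  have htr : ∀ Z : Matrix (Fin n → (∀ k : {k // k ∉ J}, S k) × C) _ ℂ,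
      (Z.submatrix (regroup (fun k : {k // k ∉ J} => S k) C n)
        (regroup (fun k : {k // k ∉ J} => S k) C n)).trace = Z.trace := fun Z =>
    (regroup (fun k : {k // k ∉ J} => S k) C n).sum_comp fun i => Z i i
  rw [hreg, marginalCompl_piTensor, submatrix_mul_equiv, submatrix_mul_equiv,
    submatrix_mul_equiv, piTensor_mul, piTensor_mul, piTensor_mul, htr, piTensor_trace,
    Finset.prod_const, Finset.card_univ, Fintype.card_fin, ← hmdef]
  set z := (m * R * m * R).trace with hz
  have hzre : (z.re : ℂ) = z := trace_collision_conj hmps.1 hRps.1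
  have hz0 : 0 ≤ z.re := re_trace_mul_nonneg
    (by simpa [hmps.1.eq] using hRps.mul_mul_conjTranspose_same m) hRps
  have hpow : (z ^ n).re = z.re ^ n := by
    rw [← hzre, ← Complex.ofReal_pow, Complex.ofReal_re, Complex.ofReal_re]
  -- An inequality suffices and also covers `z.re = 0`, where the convention `log 0 = 0` makes the
  -- right side `1`.
  have hle : z.re ≤ Real.exp (-(Real.log 2 * collisionCondEntropy m)) := by
    have : -(Real.log 2 * collisionCondEntropy m) = Real.log z.re := by
      rw [collisionCondEntropy, ← hR, ← hz, Real.logb]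
      have := Real.log_pos one_lt_two
      field_simp
    rw [this]
    exact Real.le_exp_log _
  calc (z ^ n).re = z.re ^ n := hpow
    _ ≤ Real.exp (-(Real.log 2 * collisionCondEntropy m)) ^ n := pow_le_pow_left₀ hz0 hle n
    _ = _ := by rw [← Real.exp_nat_mul]; ring_nf

end Collision

/-! ### Achievability -/

section Achievability

set_option linter.unusedSectionVars false

lemma lowProb_cases {X : Type*} [Fintype X] (d : X → ℝ) (δ : ℝ) (n : ℕ) (x : Fin n → X) :
    lowProb d δ n x = 0 ∨ lowProb d δ n x = 1 ∧ 0 < ∏ t, d (x t) ∧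
      ∏ t, d (x t) ≤ Real.exp (-(n * (shannon d - δ))) := by
  rw [lowProb]
  split_ifs with h
  · exact Or.inr ⟨rfl, h⟩
  · exact Or.inl rfl

lemma highProb_cases {X : Type*} [Fintype X] (d : X → ℝ) (δ : ℝ) (n : ℕ) (x : Fin n → X) :
    highProb d δ n x = 0 ∨ highProb d δ n x = 1 ∧
      Real.exp (-(n * (shannon d + δ))) ≤ ∏ t, d (x t) := by
  rw [highProb]
  split_ifs with h
  · exact Or.inr ⟨rfl, h⟩
  · exact Or.inl rfl

lemma IsState.exists_ofEigen {X : Type*} [Fintype X] [DecidableEq X] {ρ : Matrix X X ℂ}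
    (hρ : IsState ρ) : ∃ (U : Matrix X X ℂ) (d : X → ℝ), Uᴴ * U = 1 ∧ ρ = ofEigen U d ∧
      (∀ x, 0 ≤ d x) ∧ ∑ x, d x = 1 := by
  obtain ⟨U, d, hU, h, hd⟩ := QMAC.exists_ofEigen hρ.1.1
  refine ⟨U, d, hU, h, hd hρ.1, ?_⟩
  have := hρ.2
  rw [h, trace_ofEigen hU] at this
  exact_mod_cast this

variable {K : ℕ} {S : Fin K → Type*} {C : Type*}
  [∀ k, Fintype (S k)] [∀ k, DecidableEq (S k)] [Fintype C] [DecidableEq C]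

/-- For a state `ω` with product marginal on `S_1 ⊗ ⋯ ⊗ S_K` there are tests on `n` copies with
vanishing first error whose overlap with the cross states decays exponentially. -/
lemma exists_test {ω : Matrix ((∀ k, S k) × C) ((∀ k, S k) × C) ℂ} (hω : IsState ω)
    {σ : ∀ k, Matrix (S k) (S k) ℂ} (hσ : ∀ k, IsState (σ k)) (hωσ : traceRight ω = piTensor σ)
    {δ : ℝ} (hδ : 0 < δ) :
    ∃ T : ∀ n : ℕ, Matrix ((∀ k, Fin n → S k) × (Fin n → C)) ((∀ k, Fin n → S k) × (Fin n → C)) ℂ,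
      (∀ n, (T n).PosSemidef) ∧ (∀ n, (1 - T n).PosSemidef) ∧
      (∃ e : ℕ → ℝ, Tendsto e atTop (𝓝 0) ∧ ∀ n, ((1 - T n) * (piTensor fun _ : Fin n =>
        ω).submatrix (regroup S C n) (regroup S C n)).trace.re ≤ e n) ∧
      ∀ n (J : Finset (Fin K)), (T n * crossState J (fun k => piTensor fun _ : Fin n => σ k)
        ((piTensor fun _ : Fin n => ω).submatrix (regroup S C n) (regroup S C n))).trace.re ≤
        Real.exp (-(n * (Real.log 2 * altMutualInfo J ω - (K + 1) * δ))) := by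
  choose U d hU hUd hd hd1 using fun k => (hσ k).exists_ofEigen
  obtain ⟨V, c, hV, hVc, hc, hc1⟩ := hω.exists_ofEigen
  have hlog : 0 < Real.log 2 := Real.log_pos one_lt_two
  -- The entropy of the product marginal is additive, which matches `a ∏_k b_k` with `H(C|S)`.
  have hent : Real.log 2 * condEntropy ω = shannon c - ∑ k, shannon (d k) := by
    have h1 : entropy ω = shannon c / Real.log 2 := by rw [hVc, entropy_ofEigen hV]
    have h2 : entropy (traceRight ω) = (∑ k, shannon (d k)) / Real.log 2 := by
      rw [hωσ, funext hUd, piTensor_ofEigen, entropy_ofEigen (piTensor_unitary hU),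
        shannon_prod hd1]
    rw [condEntropy, h1, h2]
    field_simp
  have hσn : ∀ n k, (piTensor fun _ : Fin n => σ k) =
      ofEigen (piTensor fun _ : Fin n => U k) fun x => ∏ t, d k (x t) := by
    intro n k
    rw [← piTensor_ofEigen, ← hUd]
  have hWn : ∀ n k, (piTensor fun _ : Fin n => U k)ᴴ * (piTensor fun _ : Fin n => U k) = 1 :=
    fun n k => piTensor_unitary fun _ => hU k
  have hVn : ∀ n, (piTensor fun _ : Fin n => V)ᴴ * (piTensor fun _ : Fin n => V) = 1 :=
    fun n => piTensor_unitary fun _ => hV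
  obtain ⟨ωn, hωn⟩ : ∃ ωn : ∀ n : ℕ, Matrix ((∀ k, Fin n → S k) × (Fin n → C))
      ((∀ k, Fin n → S k) × (Fin n → C)) ℂ, ∀ n, ωn n =
      (piTensor fun _ : Fin n => ω).submatrix (regroup S C n) (regroup S C n) :=
    ⟨_, fun _ => rfl⟩
  have hωnps : ∀ n, (ωn n).PosSemidef := fun n => by
    rw [hωn]; exact (piTensor_posSemidef fun _ => hω.1).submatrix _
  have hωnE : ∀ n, ωn n = (ofEigen (piTensor fun _ : Fin n => V)
      fun x => ∏ t, c (x t)).submatrix (regroup S C n) (regroup S C n) := fun n => by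
    rw [hωn, ← piTensor_ofEigen, ← hVc]
  let Q₀ : ∀ n : ℕ, Matrix (∀ k, Fin n → S k) (∀ k, Fin n → S k) ℂ := fun n =>
    piTensor fun k => ofEigen (piTensor fun _ : Fin n => U k) (lowProb (d k) δ n)
  let Q : ∀ n : ℕ, Matrix ((∀ k, Fin n → S k) × (Fin n → C))
      ((∀ k, Fin n → S k) × (Fin n → C)) ℂ := fun n => Q₀ n ⊗ₖ 1
  let P : ∀ n : ℕ, Matrix ((∀ k, Fin n → S k) × (Fin n → C))
      ((∀ k, Fin n → S k) × (Fin n → C)) ℂ := fun n =>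
    (ofEigen (piTensor fun _ : Fin n => V) (highProb c δ n)).submatrix
      (regroup S C n) (regroup S C n)
  have hlow0 : ∀ n k x, 0 ≤ lowProb (d k) δ n x := fun n k x => by
    rcases lowProb_cases (d k) δ n x with h | ⟨h, -⟩ <;> simp [h]
  have hhigh0 : ∀ n x, 0 ≤ highProb c δ n x := fun n x => by
    rcases highProb_cases c δ n x with h | ⟨h, -⟩ <;> simp [h]
  have hQps : ∀ n, (Q n).PosSemidef := fun n =>
    (piTensor_posSemidef fun k => ofEigen_posSemidef _ (hlow0 n k)).kronecker PosSemidef.one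
  have hQQ : ∀ n, Q n * Q n = Q n := fun n => by
    change Q₀ n ⊗ₖ 1 * Q₀ n ⊗ₖ 1 = Q₀ n ⊗ₖ 1
    rw [← mul_kronecker_mul, Matrix.mul_one]
    congr 1
    change piTensor _ * piTensor _ = _
    rw [piTensor_mul]
    congr 1
    ext1 k
    rw [ofEigen_mul (hWn n k)]
    congr 1
    ext x
    rcases lowProb_cases (d k) δ n x with h | ⟨h, -⟩ <;> simp [h]
  have hPps : ∀ n, (P n).PosSemidef := fun n =>
    (ofEigen_posSemidef _ (hhigh0 n)).submatrix _
  have hPsub : ∀ n, 1 - P n = (ofEigen (piTensor fun _ : Fin n => V)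
      fun x => 1 - highProb c δ n x).submatrix (regroup S C n) (regroup S C n) := fun n => by
    rw [← ofEigen_sub, ofEigen_one (hVn n), ← submatrix_one_equiv (regroup S C n)]
    rfl
  have hP1 : ∀ n, (1 - P n).PosSemidef := fun n => by
    rw [hPsub]
    refine (ofEigen_posSemidef _ fun x => ?_).submatrix _
    rcases highProb_cases c δ n x with h | ⟨h, -⟩ <;> simp [h]
  have hPle : ∀ n : ℕ, P n ≤ ((Real.exp (n * (shannon c + δ)) : ℝ) : ℂ) • ωn n := fun n => by
    have hsm : ((Real.exp (n * (shannon c + δ)) : ℝ) : ℂ) • ωn n =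
        (ofEigen (piTensor fun _ : Fin n => V) fun x => Real.exp (n * (shannon c + δ)) *
          ∏ t, c (x t)).submatrix (regroup S C n) (regroup S C n) := by
      rw [hωnE, ← ofEigen_smul]
      rfl
    rw [hsm, Matrix.le_iff]
    refine (Matrix.le_iff.mp (ofEigen_mono (piTensor fun _ : Fin n => V)
      fun x => ?_)).submatrix (regroup S C n)
    rcases highProb_cases c δ n x with h | ⟨h, h'⟩
    · rw [h]
      exact mul_nonneg (Real.exp_pos _).le (Finset.prod_nonneg fun t _ => hc _)
    · rw [h]
      calc (1 : ℝ) = Real.exp (n * (shannon c + δ)) * Real.exp (-(n * (shannon c + δ))) := by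
            rw [← Real.exp_add]; simp
        _ ≤ _ := mul_le_mul_of_nonneg_left h' (Real.exp_pos _).le
  have hωntr : ∀ n, (ωn n).trace = 1 := fun n => by
    rw [hωn]
    refine ((regroup S C n).sum_comp fun i => (piTensor fun _ : Fin n => ω) i i).trans ?_
    exact (piTensor_trace _).trans (by simp [hω.2])
  have hωnR : ∀ n, traceRight (ωn n) = piTensor fun k => piTensor fun _ : Fin n => σ k := by
    intro n
    rw [hωn]
    ext s s'
    simp only [traceRight, of_apply, submatrix_apply, piTensor]
    refine (sum_prod_eq_prod_sum fun (t : Fin n) y => ω (fun k => s k t, y)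
      (fun k => s' k t, y)).trans ?_
    rw [Finset.prod_comm]
    exact Finset.prod_congr rfl fun t _ => congrFun₂ hωσ (fun k => s k t) (fun k => s' k t)
  have hQerr : ∀ n, ((1 - Q n) * ωn n).trace.re =
      1 - ∏ k, ∑ x : Fin n → S k, lowProb (d k) δ n x * ∏ t, d k (x t) := by
    intro n
    rw [Matrix.sub_mul, Matrix.one_mul, Matrix.trace_sub, hωntr]
    change (1 - (Q₀ n ⊗ₖ (1 : Matrix (Fin n → C) (Fin n → C) ℂ) * ωn n).trace).re = _
    rw [trace_kronecker_one_mul, hωnR]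
    simp only [hσn, Q₀]
    rw [piTensor_mul, piTensor_trace]
    simp only [ofEigen_mul (hWn n _), trace_ofEigen (hWn n _)]
    simp only [← Complex.ofReal_sum, ← Complex.ofReal_prod, Complex.sub_re, Complex.one_re,
      Complex.ofReal_re]
  have hPerr : ∀ n, ((1 - P n) * ωn n).trace.re =
      1 - ∑ x : Fin n → (∀ k, S k) × C, highProb c δ n x * ∏ t, c (x t) := by
    intro n
    rw [Matrix.sub_mul, Matrix.one_mul, Matrix.trace_sub, hωntr, hωnE]
    simp only [P]
    rw [submatrix_mul_equiv, ofEigen_mul (hVn n)]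
    have := (regroup S C n).sum_comp fun i => (ofEigen (piTensor fun _ : Fin n => V)
      fun x => highProb c δ n x * ∏ t, c (x t)) i i
    change (1 - ∑ i, (ofEigen (piTensor fun _ : Fin n => V)
      fun x => highProb c δ n x * ∏ t, c (x t)) (regroup S C n i) (regroup S C n i)).re = _
    rw [this]
    change (1 - (ofEigen (piTensor fun _ : Fin n => V)
      fun x => highProb c δ n x * ∏ t, c (x t)).trace).re = _
    rw [trace_ofEigen (hVn n), ← Complex.ofReal_sum, Complex.sub_re, Complex.one_re,
      Complex.ofReal_re]
  -- `Q` stands outside so that in the overlap it cuts down the cross state, after `P` has been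
  -- replaced by a multiple of `ω^{⊗n}`.
  refine ⟨fun n => Q n * P n * Q n, fun n => sandwich_posSemidef (hQps n).1 (hPps n),
    fun n => one_sub_sandwich_posSemidef (hQps n).1 (hQQ n) (hP1 n),
    ⟨fun n => 3 * ((1 - Q n) * ωn n).trace.re + 2 * ((1 - P n) * ωn n).trace.re, ?_, fun n => ?_⟩,
    fun n J => ?_⟩
  · simp only [hQerr, hPerr]
    have h1 : Tendsto (fun n : ℕ => ∏ k, ∑ x : Fin n → S k, lowProb (d k) δ n x * ∏ t, d k (x t))
        atTop (𝓝 (∏ _k : Fin K, 1)) :=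
      tendsto_finsetProd _ fun k _ => tendsto_sum_lowProb (hd k) (hd1 k) hδ
    have h2 := tendsto_sum_highProb hc hc1 hδ
    have := ((h1.const_sub 1).const_mul 3).add ((h2.const_sub 1).const_mul 2)
    simpa using this
  · rw [← hωn]
    exact re_trace_one_sub_sandwich_le (hQps n).1 (hQQ n) (hPps n) (hP1 n) (hωnps n)
  · rw [← hωn]
    simp only [hσn]
    refine (re_trace_mul_crossState_le J (hωnps n) (hWn n)
      (b := fun k => Real.exp (-(n * (shannon (d k) - δ)))) (fun k => (Real.exp_pos _).le)
      (fun k x => Finset.prod_nonneg fun t _ => hd k _)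
      (fun k x => lowProb_cases (d k) δ n x) (Real.exp_pos _).le (hPle n)).trans ?_
    have hm : traceRight (marginalCompl J ω) =
        piTensor fun k : {k // k ∉ J} => ofEigen (U k) (d k) := by
      rw [traceRight_marginalCompl J (fun k => (hσ k).2) hωσ]
      exact congrArg piTensor (funext fun k => hUd _)
    have hcoll := trace_collision_pow J hω.1 hU hd hm n
    rw [← hωn] at hcoll
    refine (mul_le_mul_of_nonneg_left hcoll (mul_nonneg (Real.exp_pos _).le
      (Finset.prod_nonneg fun k _ => (Real.exp_pos _).le))).trans (le_of_eq ?_)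
    -- One `δ` comes from `a` and one from each of the `K` factors `b_k`, hence `(K + 1) δ`.
    rw [← Real.exp_sum, ← Real.exp_add, ← Real.exp_add, altMutualInfo, mul_sub (Real.log 2), hent]
    congr 1
    simp only [Finset.sum_neg_distrib, ← Finset.mul_sum, Finset.sum_sub_distrib, Finset.sum_const,
      Finset.card_univ, Fintype.card_fin, nsmul_eq_mul]
    ring

/-- The number of wrong messages of one sender is at most the unrounded `2^{n(R - δ)}`, even for
negative exponents. -/
lemma natCast_ceil_sub_one_le {x : ℝ} (hx : 0 ≤ x) : ((⌈x⌉₊ - 1 : ℕ) : ℝ) ≤ x := by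
  have h := Nat.ceil_lt_add_one hx
  rcases Nat.eq_zero_or_pos ⌈x⌉₊ with h0 | h0
  · simp [h0, hx]
  · rw [Nat.cast_sub h0, Nat.cast_one]
    linarith

/-- Achievability of the rate region by simultaneous decoding. -/
lemma achievableBySimultaneousDecoding {A : Fin K → Type*}
    [∀ k, Fintype (A k)] [∀ k, DecidableEq (A k)]
    {N : Matrix (∀ k, A k) (∀ k, A k) ℂ →ₗ[ℂ] Matrix C C ℂ} (hN : IsChannel N)
    {θ : ∀ k, Matrix (S k × A k) (S k × A k) ℂ} (hθ : ∀ k, IsState (θ k))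
    {rate : Fin K → ℝ}
    (hrate : ∀ J : Finset (Fin K), J.Nonempty →
      ∑ j ∈ J, rate j ≤ altMutualInfo J (outputState N θ)) :
    AchievableBySimultaneousDecoding N θ rate := by
  intro ε hε _ δ hδ
  have hlog : 0 < Real.log 2 := Real.log_pos one_lt_two
  have hω : IsState (outputState N θ) := by
    refine ⟨idTensor_posSemidef hN (IsState.tensorBipartite hθ).1, ?_⟩
    rw [← trace_traceRight, outputState, traceRight_idTensor hN, trace_traceRight]
    exact (IsState.tensorBipartite hθ).2
  have hωσ : traceRight (outputState N θ) = piTensor fun k => traceRight (θ k) := by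
    rw [outputState, traceRight_idTensor hN, traceRight_tensorBipartite]
  -- With this typicality slack, `(K + 1) δ'` uses up half of the rate reduction `δ log 2`; the
  -- other half is the exponential decay.
  have hδ' : 0 < δ * Real.log 2 / (2 * (K + 1)) := by positivity
  obtain ⟨T, hT, hT1, ⟨e, he, hTe⟩, hTJ⟩ :=
    exists_test hω (fun k => (hθ k).traceRight) hωσ hδ'
  have hlim : Tendsto (fun n : ℕ => 2 * e n +
      4 * (2 ^ K * Real.exp (-(δ * Real.log 2 / 2)) ^ n)) atTop (𝓝 0) := by
    have h1 : Real.exp (-(δ * Real.log 2 / 2)) < 1 := by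
      rw [Real.exp_lt_one_iff]
      have := mul_pos hδ hlog
      linarith
    have h2 := tendsto_pow_atTop_nhds_zero_of_lt_one (Real.exp_pos _).le h1
    simpa using (he.const_mul 2).add ((h2.const_mul (2 ^ K)).const_mul 4)
  filter_upwards [hlim.eventually (ge_mem_nhds hε)] with n hn
  have hΘ : ∀ k, IsState (tensorBipartite fun _ : Fin n => θ k) := fun k =>
    IsState.tensorBipartite fun _ => hθ k
  refine ⟨positionBasedCode _ hΘ (hT n), ⟨fun _ => rfl, fun _ _ => rfl⟩,
    ⟨T n, hT n, hT1 n, fun _ => rfl⟩, le_trans ?_ hn⟩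
  have hchan := idTensor_channelPow N θ n
  refine avgErrorProb_positionBasedCode_le (fun k => Nat.ceil_pos.mpr (by positivity)) hΘ (hT n)
    (hT1 n) ?_ ?_ (fun J hJ => ?_) (by positivity)
  · rw [hchan]
    exact (piTensor_posSemidef fun _ => hω.1).submatrix _
  · rw [hchan]
    exact hTe n
  · rw [hchan]
    simp only [traceRight_tensorBipartite]
    have h1 : ((∏ j ∈ J, (⌈(2 : ℝ) ^ ((n : ℝ) * (rate j - δ))⌉₊ - 1) : ℕ) : ℝ) ≤
        Real.exp (n * (Real.log 2 * (∑ j ∈ J, rate j - J.card * δ))) := by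
      rw [Nat.cast_prod]
      refine (Finset.prod_le_prod (fun j _ => Nat.cast_nonneg _) fun j _ =>
        natCast_ceil_sub_one_le (by positivity)).trans (le_of_eq ?_)
      simp only [Real.rpow_def_of_pos two_pos]
      rw [← Real.exp_sum]
      congr 1
      rw [← Finset.mul_sum, ← Finset.mul_sum, Finset.sum_sub_distrib, Finset.sum_const,
        nsmul_eq_mul]
      ring
    refine (mul_le_mul_of_nonneg_left (hTJ n J) (Nat.cast_nonneg _)).trans
      ((mul_le_mul_of_nonneg_right h1 (Real.exp_pos _).le).trans ?_)
    rw [← Real.exp_add, ← Real.exp_nat_mul, Real.exp_le_exp]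
    -- Each sender in `J` backs off by `δ`, so a nonempty `J` gains at least one `δ` in the
    -- exponent.
    have h2 : (1 : ℝ) ≤ J.card := by exact_mod_cast hJ.card_pos
    have h3 := mul_le_mul_of_nonneg_left (hrate J hJ) hlog.le
    have h4 : ((K : ℝ) + 1) * (δ * Real.log 2 / (2 * (K + 1))) = δ * Real.log 2 / 2 := by
      field_simp
    have h5 : Real.log 2 * δ ≤ Real.log 2 * (J.card * δ) :=
      mul_le_mul_of_nonneg_left (le_mul_of_one_le_left hδ.le h2) hlog.le
    rw [h4, ← mul_neg, ← mul_add]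
    refine mul_le_mul_of_nonneg_left ?_ (Nat.cast_nonneg n)
    rw [mul_sub]
    linarith

end Achievability

end QMAC

end

theorem mainTheorem5 {K : ℕ} {A S : Fin K → Type*} {C : Type*}
    [∀ k, Fintype (A k)] [∀ k, DecidableEq (A k)]
    [∀ k, Fintype (S k)] [∀ k, DecidableEq (S k)] [Fintype C] [DecidableEq C]
    (N : Matrix (∀ k, A k) (∀ k, A k) ℂ →ₗ[ℂ] Matrix C C ℂ) (hN : QMAC.IsChannel N)
    (θ : ∀ k, Matrix (S k × A k) (S k × A k) ℂ) (hθ : ∀ k, QMAC.IsState (θ k))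
    (rate : Fin K → ℝ)
    (hrate : ∀ J : Finset (Fin K), J.Nonempty →
      ∑ j ∈ J, rate j ≤ QMAC.altMutualInfo J (QMAC.outputState N θ)) :
    QMAC.AchievableBySimultaneousDecoding N θ rate :=
  QMAC.achievableBySimultaneousDecoding hN hθ hrate
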